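/- Let $g\ge 2$, $n\ge 1$, and let $k_1,\dots,k_n\ge 1$ be integers with $k_1+\dots+k_n=2g-2$. Let $\mathcal H(k_1,\dots,k_n)$ be the stratum of pairs $(X,\omega)$, where $X$ is a compact connected Riemann surface of genus $g$ and $\omega$ is a holomorphic one-form on $X$ with exactly $n$ distinct zeros, of orders $k_1,\dots,k_n$. Call a direction $\theta\in S^1$ completely periodic on $(X,\omega)$ if $X$ minus the zeros of $\omega$ is the union of a family of pairwise disjoint open flat cylinders in direction $\theta$ and of saddle connections in direction $\theta$. Then almost every $(X,\omega)\in\mathcal H(k_1,\dots,k_n)$, with respect to Lebesgue measure in period coordinates, has no completely periodic direction. Explicitly: let $S$ be a closed surface of genus $g$ with $n$ distinct points $p_1,\dots,p_n$, and let $b_1,\dots,b_d$, $d=2g+n-1$, be a basis of $H_1(S,\{p_1,\dots,p_n\};\mathbb Z)$. For a surface $(X,\omega)$ in the stratum with a marking, i.e. a homeomorphism $h:S\to X$ that maps each $p_i$ to a zero of order $k_i$, the period coordinates are $\left(\int_{h_*b_1}\omega,\dots,\int_{h_*b_d}\omega\right)\in\mathbb C^d$. Then for Lebesgue-almost every $z\in\mathbb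 C^d$, no marked surface $(X,\omega,h)$ with period coordinates $z$ has a completely periodic direction. -/

import Mathlib

open MeasureTheory Set Filter Topology
open scoped Manifold ContDiff

namespace TranslationSurface

universe u

/-! ### Abelian differentials on a Riemann surface -/

section OneForms

variable {X : Type u} [TopologicalSpace X] [ChartedSpace ℂ X]

/-- The coefficient `f` of a one-form `η = f(z) dz` in the chart `e`. -/
noncomputable def coefficient (η : ∀ x : X, TangentSpace 𝓘(ℂ, ℂ) x →L[ℂ] ℂ)
    (e : OpenPartialHomeomorph X ℂ) (z : ℂ) : ℂ :=
  η (e.symm z) (mfderiv 𝓘(ℂ, ℂ) 𝓘(ℂ, ℂ) e.symm z (1 : ℂ))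

variable (X) in
/-- A holomorphic one-form on `X`: a cotangent vector `η x` at every point, with holomorphic
coefficient in every chart. -/
structure HolomorphicOneForm where
  form : ∀ x : X, TangentSpace 𝓘(ℂ, ℂ) x →L[ℂ] ℂ
  holomorphic : ∀ e ∈ atlas ℂ X, DifferentiableOn ℂ (coefficient form e) e.target

variable (η : HolomorphicOneForm X)

/-- The set of zeros of `η`, i.e. the singularities of the flat structure. -/
def zeros : Set X := {x | η.form x = 0}

/-- The order of vanishing of `η` at `x`. -/
noncomputable def zeroOrder (x : X) : ℕ∞ :=
  analyticOrderAt (coefficient η.form (chartAt ℂ x)) (chartAt ℂ x x)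

/-- `G` is a primitive of `η` on `U`: `dG = η` there. Away from the zeros of `η`, such primitives
are locally injective, and they are the translation charts of the flat structure. -/
def IsPrimitiveOn (G : X → ℂ) (U : Set X) : Prop :=
  ∀ y ∈ U, HasMFDerivAt 𝓘(ℂ, ℂ) 𝓘(ℂ, ℂ) G y (η.form y)

/-- The continuous map `c : A → X` is developed by `D : A → ℂ`: locally on `A`, the
functions `D` and `G ∘ c` differ by a constant, for a local primitive `G` of `η`. -/
def IsDevelopedBy {T : Type*} [TopologicalSpace T] (A : Set T) (c : T → X) (D : T → ℂ) : Prop :=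
  ContinuousOn c A ∧ ∀ t ∈ A, ∃ (U : Set X) (G : X → ℂ), IsOpen U ∧ c t ∈ U ∧
    IsPrimitiveOn η G U ∧ ∀ᶠ s in 𝓝[A] t, G (c s) - G (c t) = D s - D t

/-- `∫_γ η = a`, the integral along a continuous path being the total increment of a continuous
choice of primitives of `η` along the path. -/
def HasIntegral {x y : X} (γ : Path x y) (a : ℂ) : Prop :=
  ∃ D : unitInterval → ℂ, IsDevelopedBy η univ γ D ∧ D 1 - D 0 = a

/-! ### Cylinders, saddle connections, completely periodic directions

Directions are given by complex numbers `u` of modulus one. -/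

/-- `C` is an open flat cylinder in the direction `u`, with closed geodesics of some length `w` and
some height `h`: the image of the strip `0 < Im z < h` under a map that reads `z ↦ u z + const`
in translation charts and identifies exactly the points that differ by an integer multiple
of `w`. -/
def IsCylinder (u : ℂ) (C : Set X) : Prop :=
  ∃ (w h : ℝ) (Φ : ℂ → X), 0 < w ∧ 0 < h ∧
    IsDevelopedBy η {z : ℂ | 0 < z.im ∧ z.im < h} Φ (fun z ↦ u * z) ∧
    (∀ z z' : ℂ, 0 < z.im → z.im < h → 0 < z'.im → z'.im < h →
      (Φ z = Φ z' ↔ ∃ m : ℤ, z' = z + m * w)) ∧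
    C = Φ '' {z : ℂ | 0 < z.im ∧ z.im < h} ∧ Disjoint C (zeros η)

/-- `L` is (the relative interior of) a saddle connection in the direction `u`: a geodesic
segment of some positive length `l` that joins two zeros and has no zero in its interior. -/
def IsSaddleConnection (u : ℂ) (L : Set X) : Prop :=
  ∃ (l : ℝ) (c : ℝ → X), 0 < l ∧ IsDevelopedBy η (Icc 0 l) c (fun t ↦ u * t) ∧
    c 0 ∈ zeros η ∧ c l ∈ zeros η ∧ L = c '' Ioo 0 l ∧ Disjoint L (zeros η)

/-- The direction `u` is completely periodic: apart from the zeros, the surface is decomposed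
into disjoint open cylinders and saddle connections in the direction `u`. -/
def IsCompletelyPeriodic (u : ℂ) : Prop :=
  ∃ 𝒞 : Set (Set X), (∀ C ∈ 𝒞, IsCylinder η u C) ∧ 𝒞.PairwiseDisjoint id ∧
    ∀ x : X, x ∉ zeros η → x ∉ ⋃₀ 𝒞 → ∃ L, IsSaddleConnection η u L ∧ x ∈ L

end OneForms

/-! ### Strata and period coordinates -/

section Strata

variable {S : Type u} [TopologicalSpace S] {n : ℕ}

/-- A point of the stratum `ℋ(k₁, …, kₙ)` with a marking by `(S, p₁, …, pₙ)`: a compact connected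
Riemann surface `X`, a holomorphic one-form on it whose zeros are `n` points of orders `kᵢ ≥ 1`,
and a homeomorphism `S ≃ X` that maps the points `pᵢ` to the zeros. -/
structure MarkedSurface (p : Fin n → S) (k : Fin n → ℕ) where
  X : Type u
  [topology : TopologicalSpace X]
  [charts : ChartedSpace ℂ X]
  [complexManifold : IsManifold 𝓘(ℂ, ℂ) ω X]
  [compact : CompactSpace X]
  [hausdorff : T2Space X]
  [connected : ConnectedSpace X]
  form : HolomorphicOneForm X
  marking : S ≃ₜ X
  zeros_eq : zeros form = range (fun i ↦ marking (p i))
  zeroOrder_eq : ∀ i, zeroOrder form (marking (p i)) = k i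

attribute [instance] MarkedSurface.topology MarkedSurface.charts MarkedSurface.complexManifold
  MarkedSurface.compact MarkedSurface.hausdorff MarkedSurface.connected

/-- Homotopy classes, with fixed end points, of paths in `S` between two of the points `pᵢ`. -/
abbrev PathClass (p : Fin n → S) : Type u :=
  Σ i j : Fin n, Path.Homotopic.Quotient (p i) (p j)

/-- The relations `[α β] = [α] + [β]`. -/
def concatRelations (p : Fin n → S) : Set (FreeAbelianGroup (PathClass p)) :=
  {x | ∃ (i j l : Fin n) (α : Path.Homotopic.Quotient (p i) (p j))
    (β : Path.Homotopic.Quotient (p j) (p l)),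
    x = FreeAbelianGroup.of ⟨i, l, α.trans β⟩ - FreeAbelianGroup.of ⟨i, j, α⟩
      - FreeAbelianGroup.of ⟨j, l, β⟩}

/-- The relative homology group `H₁(S, {p₁, …, pₙ}; ℤ)` of a path connected space `S` and distinct
points `p₁, …, pₙ`, `n ≥ 1`, presented as the abelianization of the fundamental groupoid of `S`
based at these points: generators are the homotopy classes of paths between the points, relations
are `[α β] = [α] + [β]`. -/
abbrev RelativeHomology (p : Fin n → S) : Type u :=
  FreeAbelianGroup (PathClass p) ⧸ AddSubgroup.closure (concatRelations p)

/-- The relative homology class of a path between two of the points `pᵢ`. -/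
def homologyClass (p : Fin n → S) {i j : Fin n} (γ : Path (p i) (p j)) : RelativeHomology p :=
  QuotientAddGroup.mk (FreeAbelianGroup.of ⟨i, j, Path.Homotopic.Quotient.mk γ⟩)

/-- `v` is the period homomorphism `[γ] ↦ ∫_γ η` of the marked surface `M`. -/
def IsPeriodHom {p : Fin n → S} {k : Fin n → ℕ} (M : MarkedSurface p k)
    (v : RelativeHomology p →+ ℂ) : Prop :=
  ∀ (i j : Fin n) (γ : Path (p i) (p j)),
    HasIntegral M.form (γ.map M.marking.continuous) (v (homologyClass p γ))

/-- `z` is the vector of period coordinates of `M` with respect to the basis `b` of the relative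
homology group: its entries are the integrals of the one-form over the elements of `b`. -/
def HasPeriodCoordinates {p : Fin n → S} {k : Fin n → ℕ} {d : ℕ}
    (b : Module.Basis (Fin d) ℤ (RelativeHomology p)) (M : MarkedSurface p k)
    (z : Fin d → ℂ) : Prop :=
  ∃ v : RelativeHomology p →+ ℂ, IsPeriodHom M v ∧ ∀ j, z j = v (b j)

end Strata

end TranslationSurface

/-! A completely periodic direction `u` forces an integral coincidence among the periods. Each
cylinder `C` of height `h` carries a circle-valued height function with values in `ℝ / hℤ`, zero off
`C` (`IsBand.exists_height`). It vanishes at the zeros of the form, so it defines an integral class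
`N C` on relative homology (`exists_winding`). Moving along the surface changes the coordinate
transverse to `u` exactly by the total change of the heights (`HeightData.im_integral`), whence `Im
(conj u * v) = ∑ h C * N C` for the period homomorphism `v`. Homology classes killed by all the `N
C` have periods parallel to `u`. With at most `d - 2` cylinders, the common kernel has rank at least
two, so two independent classes have parallel periods (`MarkedSurface.exists_parallel_periods`). For
a fixed pair of independent integer vectors this is a null condition on `z`
(`ae_im_conj_mul_ne_zero`), and there are only countably many pairs.

The bound on the number of cylinders is `card_cylinders_lt`, where `∑ (k i + 1) = 2g - 2 + n = d -
1`. The lower edge of every cylinder contains a zero, and there the cylinder fills a half-plane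
sector next to an outgoing ray. Distinct cylinders fill distinct sectors, and there are `∑ (k i +
1)` rays. Equality would leave only one corner on each edge, so that every edge is a single saddle
connection closing up at its zero. A ray then bounds a cylinder on each side. Followed along the
cylinder on its left, it returns at angle `π / (k i + 1)`; along the one on its right, at angle `-π
/ (k i + 1)`. Both are the same geodesic, which is impossible for `k i ≥ 1`. -/

namespace TranslationSurface

universe u

set_option linter.unusedSectionVars false

/-! ### Elementary topology and complex analysis -/

/-- Two continuous nonvanishing functions on a connected set with the same `m`-th power differ by
a constant root of unity. -/
theorem exists_root_mul_eq {T : Type*} [TopologicalSpace T] {A : Set T} (hA : IsPreconnected A)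
    (hne : A.Nonempty) {t γ : T → ℂ} (ht : ContinuousOn t A) (hγ : ContinuousOn γ A) {m : ℕ}
    (hm : m ≠ 0) (hγ0 : ∀ a ∈ A, γ a ≠ 0) (h : ∀ a ∈ A, t a ^ m = γ a ^ m) :
    ∃ ξ : ℂ, ξ ^ m = 1 ∧ ∀ a ∈ A, t a = ξ * γ a := by
  obtain ⟨a₀, ha₀⟩ := hne
  have hroot : ∀ a ∈ A, (t a / γ a) ^ m = 1 := fun a ha ↦ by
    rw [div_pow, h a ha, div_self (pow_ne_zero _ (hγ0 a ha))]
  have hfin : {ξ : ℂ | ξ ^ m = 1}.Finite := by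
    refine (Polynomial.nthRoots m (1 : ℂ)).toFinset.finite_toSet.subset fun ξ hξ ↦ ?_
    simpa [Polynomial.mem_nthRoots (Nat.pos_of_ne_zero hm)] using hξ
  refine ⟨t a₀ / γ a₀, hroot a₀ ha₀, fun a ha ↦ ?_⟩
  have hc : t a / γ a = t a₀ / γ a₀ :=
    hA.constant_of_mapsTo (f := fun a ↦ t a / γ a) hfin.isDiscrete (ht.div hγ hγ0) hroot ha ha₀
  rw [← hc, div_mul_cancel₀ _ (hγ0 a ha)]

/-- A continuous real function with countably many values on a connected set is constant. -/
theorem eq_of_countable_image {T : Type*} [TopologicalSpace T] {A : Set T} (hA : IsPreconnected A)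
    {F : T → ℝ} (hF : ContinuousOn F A) (hc : (F '' A).Countable) {x y : T} (hx : x ∈ A)
    (hy : y ∈ A) : F x = F y :=
  hc.isTotallyDisconnected _ subset_rfl (hA.image _ hF) (mem_image_of_mem _ hx)
    (mem_image_of_mem _ hy)

/-- A locally constant function on a subset of a second countable space has countably many
values. -/
theorem countable_image_of_locally_const {T Y : Type*} [TopologicalSpace T]
    [SecondCountableTopology T] {W : Set T} {F : T → Y}
    (h : ∀ x ∈ W, ∀ᶠ y in 𝓝[W] x, F y = F x) : (F '' W).Countable := by
  obtain ⟨t, htW, htc, hcov⟩ := TopologicalSpace.countable_cover_nhdsWithin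
    (f := fun x ↦ {y | F y = F x}) h
  refine (htc.image F).mono ?_
  rintro _ ⟨y, hy, rfl⟩
  obtain ⟨x, hx, hxy⟩ := mem_iUnion₂.1 (hcov hy)
  exact ⟨x, hx, Eq.symm hxy⟩

/-- Two continuous real functions that agree modulo `h` differ by a constant locally. -/
theorem eventually_sub_eq_of_addCircle {T : Type*} [TopologicalSpace T] {A : Set T} {a : T}
    {h : ℝ} (hh : 0 < h) {F G : T → ℝ} (ha : a ∈ A) (hF : ContinuousWithinAt F A a)
    (hG : ContinuousWithinAt G A a) (hFG : ∀ s ∈ A, (F s : AddCircle h) = (G s : AddCircle h)) :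
    ∀ᶠ s in 𝓝[A] a, F s - F a = G s - G a := by
  have hc : ContinuousWithinAt (fun s ↦ (F s - F a) - (G s - G a)) A a :=
    (hF.sub continuousWithinAt_const).sub (hG.sub continuousWithinAt_const)
  have hev : ∀ᶠ s in 𝓝[A] a, |(F s - F a) - (G s - G a)| < h := by
    have h0 : Tendsto (fun s ↦ |(F s - F a) - (G s - G a)|) (𝓝[A] a) (𝓝 0) := by
      simpa using hc.tendsto.abs
    exact h0.eventually_lt_const hh
  filter_upwards [hev, self_mem_nhdsWithin] with s hs hsA
  have key : (((F s - F a) - (G s - G a) : ℝ) : AddCircle h) = 0 := by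
    simp only [AddCircle.coe_sub, hFG s hsA, hFG a ha, sub_self]
  obtain ⟨n, hn⟩ := AddCircle.coe_eq_zero_iff h |>.1 key
  rw [zsmul_eq_mul] at hn
  rw [← hn, abs_mul, abs_of_pos hh] at hs
  have hn1 : |(n : ℝ)| < 1 := by
    by_contra hcon
    push Not at hcon
    nlinarith
  have hn0 : n = 0 := by
    have : |n| < 1 := by exact_mod_cast hn1
    exact Int.abs_lt_one_iff.1 this
  rw [hn0] at hn
  simp at hn
  linarith

/-- A holomorphic function vanishing to order `m ≥ 1` is `w * R ^ m` for a local coordinate `R`. -/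
theorem exists_openPartialHomeomorph_pow {F : ℂ → ℂ} {z₀ w : ℂ} {m : ℕ} (hF : AnalyticAt ℂ F z₀)
    (hord : analyticOrderAt F z₀ = m) (hm : m ≠ 0) (hw : w ≠ 0) :
    ∃ R : OpenPartialHomeomorph ℂ ℂ, z₀ ∈ R.source ∧ R z₀ = 0 ∧
      ∀ᶠ z in 𝓝 z₀, F z = w * R z ^ m := by
  obtain ⟨g, hg, hg0, hFg⟩ := (hF.analyticOrderAt_eq_natCast).1 hord
  set b : ℂ := g z₀ / w
  have hb : b ≠ 0 := div_ne_zero hg0 hw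
  -- Dividing by the value `b` at `z₀` puts the argument of the second power at `1`, inside the slit
  -- plane, where the principal root is analytic.
  set q : ℂ → ℂ := fun z ↦ b ^ ((1 : ℂ) / m) * (g z / w / b) ^ ((1 : ℂ) / m)
  have hmC : (m : ℂ) ≠ 0 := Nat.cast_ne_zero.2 hm
  have hqm : ∀ z, q z ^ m = g z / w := fun z ↦ by
    simp only [q, mul_pow, one_div, Complex.cpow_nat_inv_pow _ hm]
    field_simp
  have hqan : AnalyticAt ℂ q z₀ := by
    refine analyticAt_const.mul (AnalyticAt.cpow ?_ analyticAt_const ?_)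
    · exact (hg.div analyticAt_const hw).div analyticAt_const hb
    · have : g z₀ / w / b = 1 := div_self hb
      rw [this]; exact Complex.one_mem_slitPlane
  have hq0 : q z₀ ≠ 0 := fun h0 ↦ by
    have := hqm z₀
    rw [h0, zero_pow hm] at this
    exact hb this.symm
  set T : ℂ → ℂ := fun z ↦ (z - z₀) * q z
  have hT : AnalyticAt ℂ T z₀ := (analyticAt_id.sub analyticAt_const).mul hqan
  have hTd : HasDerivAt T (q z₀) z₀ := by
    exact (((hasDerivAt_id z₀).sub_const z₀).mul hqan.differentiableAt.hasDerivAt).congr_deriv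
      (by simp)
  have hTs : HasStrictDerivAt T (q z₀) z₀ := hTd.deriv ▸ hT.hasStrictDerivAt
  have hTe := hTs.hasStrictFDerivAt_equiv hq0
  refine ⟨hTe.toOpenPartialHomeomorph T, hTe.mem_toOpenPartialHomeomorph_source, ?_, ?_⟩
  · simp [T]
  · filter_upwards [hFg] with z hz
    simp only [HasStrictFDerivAt.toOpenPartialHomeomorph_coe, T, mul_pow, hqm, hz, smul_eq_mul]
    field_simp

theorem apply_one_eq_mul {L M : ℂ →L[ℂ] ℂ} (h : M.comp L = ContinuousLinearMap.id ℂ ℂ)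
    (N : ℂ →L[ℂ] ℂ) : N 1 = L 1 * N (M 1) := by
  have h2 : M (L 1) = 1 := congrArg (fun f : ℂ →L[ℂ] ℂ ↦ f 1) h
  have h3 : M (L 1) = L 1 * M 1 := by
    conv_lhs => rw [← mul_one (L 1), ← smul_eq_mul, map_smul, smul_eq_mul]
  have h4 : N (L 1 * M 1) = L 1 * N (M 1) := by
    rw [← smul_eq_mul, map_smul, smul_eq_mul]
  rw [← h4, ← h3, h2]

/-! ### Flat charts: the normal form of a one-form near a point -/

section OneForms
variable {X : Type u} [TopologicalSpace X] [ChartedSpace ℂ X] [IsManifold 𝓘(ℂ, ℂ) ω X]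
  (η : HolomorphicOneForm X)

theorem form_eq_toSpanSingleton_comp {φ : OpenPartialHomeomorph X ℂ} (hφ : φ ∈ atlas ℂ X)
    {y : X} (hy : y ∈ φ.source) :
    η.form y = (ContinuousLinearMap.toSpanSingleton ℂ
      (coefficient η.form φ (φ y))).comp (mfderiv 𝓘(ℂ, ℂ) 𝓘(ℂ, ℂ) φ y) := by
  have hsc := (mdifferentiable_of_mem_atlas (I := 𝓘(ℂ, ℂ)) hφ).symm_comp_deriv hy
  -- The type of `η.form` depends on the base point; naming `φ.symm (φ y)` as a variable `y'` allows
  -- it to be replaced by `y`.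
  have key : ∀ (y' : X) (_ : y' = y) (L M N N' : ℂ →L[ℂ] ℂ), M.comp L = ContinuousLinearMap.id ℂ ℂ →
      N = η.form y → N' = η.form y' → N 1 = L 1 * N' (M 1) := by
    rintro y' rfl L M N N' hLM rfl rfl
    exact apply_one_eq_mul hLM _
  have hext : ∀ N N' : ℂ →L[ℂ] ℂ, N 1 = N' 1 → N = N' := fun _ _ ↦ ContinuousLinearMap.ext_ring
  exact hext _ _ (key _ (φ.left_inv hy) (mfderiv 𝓘(ℂ, ℂ) 𝓘(ℂ, ℂ) φ y)
      (mfderiv 𝓘(ℂ, ℂ) 𝓘(ℂ, ℂ) φ.symm (φ y)) _ _ hsc rfl rfl)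

/-- A primitive of the coefficient of `η` in a chart, read on the surface, is a primitive of `η`. -/
theorem hasMFDerivAt_comp_chart {φ : OpenPartialHomeomorph X ℂ} (hφ : φ ∈ atlas ℂ X) {F : ℂ → ℂ}
    {y : X} (hy : y ∈ φ.source) (hF : HasDerivAt F (coefficient η.form φ (φ y)) (φ y)) :
    HasMFDerivAt 𝓘(ℂ, ℂ) 𝓘(ℂ, ℂ) (F ∘ φ) y (η.form y) := by
  have hmd : φ.MDifferentiable 𝓘(ℂ, ℂ) 𝓘(ℂ, ℂ) := mdifferentiable_of_mem_atlas hφ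
  rw [form_eq_toSpanSingleton_comp η hφ hy]
  exact (hF.hasFDerivAt.hasMFDerivAt).comp y (hmd.mdifferentiableAt hy).hasMFDerivAt

theorem zeroOrder_eq_zero {x : X} (hx : x ∉ zeros η) : zeroOrder η x = 0 := by
  set φ := chartAt ℂ x
  have hxφ : x ∈ φ.source := mem_chart_source ℂ x
  have hd : DifferentiableOn ℂ (coefficient η.form φ) φ.target :=
    η.holomorphic φ (chart_mem_atlas ℂ x)
  have han : AnalyticAt ℂ (coefficient η.form φ) (φ x) :=
    hd.analyticAt (φ.open_target.mem_nhds (φ.map_source hxφ))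
  refine han.analyticOrderAt_eq_zero.2 fun h0 ↦ hx ?_
  have h1 := form_eq_toSpanSingleton_comp η (chart_mem_atlas ℂ x) hxφ
  rw [h0] at h1
  have h2 : ∀ L : ℂ →L[ℂ] ℂ, (ContinuousLinearMap.toSpanSingleton ℂ (0 : ℂ)).comp L = 0 :=
    fun L ↦ by ext; simp
  exact h1.trans (h2 _)

/-- A chart of the surface at `x` in which `u * e ^ m` is a primitive of `η`. -/
structure IsFlatChart (u : ℂ) (m : ℕ) (x : X) (e : OpenPartialHomeomorph X ℂ) (r : ℝ) :
    Prop where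
  mem_source : x ∈ e.source
  map_center : e x = 0
  pos : 0 < r
  target_eq : e.target = Metric.ball 0 r
  primitive : IsPrimitiveOn η (fun y ↦ u * e y ^ m) e.source

/-- A primitive of the coefficient that vanishes at `x` has order `k + 1` there, hence is `u` times
the power of a local coordinate. Absorbing `u` turns the geodesics leaving `x` in direction `u` into
the rays through the `(k + 1)`-st roots of unity; `k = 0` gives a translation chart. -/
theorem exists_isFlatChart {u : ℂ} (hu : u ≠ 0) {x : X} {k : ℕ} (hk : zeroOrder η x = k) :
    ∃ e r, IsFlatChart η u (k + 1) x e r := by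
  set φ := chartAt ℂ x
  set f := coefficient η.form φ
  have hxφ : x ∈ φ.source := mem_chart_source ℂ x
  have hdf : DifferentiableOn ℂ f φ.target := η.holomorphic φ (chart_mem_atlas ℂ x)
  obtain ⟨ρ, hρ, hball⟩ := Metric.isOpen_iff.1 φ.open_target _ (φ.map_source hxφ)
  obtain ⟨F, hF0, hF⟩ := Complex.IsExactOn.with_val_at
    (hdf.mono hball).isExactOn_ball (φ x) 0
  have hFd : DifferentiableOn ℂ F (Metric.ball (φ x) ρ) :=
    fun z hz ↦ (hF z hz).differentiableAt.differentiableWithinAt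
  have hbn : Metric.ball (φ x) ρ ∈ 𝓝 (φ x) := Metric.ball_mem_nhds _ hρ
  have hFan : AnalyticAt ℂ F (φ x) := hFd.analyticAt hbn
  have hderiv : deriv F =ᶠ[𝓝 (φ x)] f := by
    filter_upwards [hbn] with z hz using (hF z hz).deriv
  have hord : analyticOrderAt F (φ x) = (k + 1 : ℕ) := by
    have h1 := hFan.analyticOrderAt_deriv_add_one
    rw [analyticOrderAt_congr hderiv] at h1
    simp only [hF0, sub_zero] at h1
    rw [← h1]
    change zeroOrder η x + 1 = _
    rw [hk]; rfl
  obtain ⟨R, hxR, hR0, hFR⟩ := exists_openPartialHomeomorph_pow hFan hord k.succ_ne_zero hu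
  obtain ⟨V, hV, hVo, hxV⟩ := eventually_nhds_iff.1 hFR
  set W : Set ℂ := V ∩ Metric.ball (φ x) ρ
  have hWo : IsOpen W := hVo.inter Metric.isOpen_ball
  set e₀ := φ.trans (R.restrOpen W hWo)
  have hxW : φ x ∈ W := ⟨hxV, Metric.mem_ball_self hρ⟩
  have hxe : x ∈ e₀.source := by
    simp only [e₀, OpenPartialHomeomorph.trans_source, OpenPartialHomeomorph.restrOpen_source]
    exact ⟨hxφ, hxR, hxW⟩
  have he0 : e₀ x = 0 := hR0
  obtain ⟨r, hr, hrb⟩ := Metric.isOpen_iff.1 e₀.open_target _ (e₀.map_source hxe)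
  rw [he0] at hrb
  have hsrc : ∀ y ∈ e₀.source, y ∈ φ.source ∧ φ y ∈ W := fun y hy ↦ by
    simp only [e₀, OpenPartialHomeomorph.trans_source, OpenPartialHomeomorph.restrOpen_source] at hy
    exact ⟨hy.1, hy.2.2⟩
  have hprim : IsPrimitiveOn η (fun y ↦ u * e₀ y ^ (k + 1)) e₀.source := by
    intro y hy
    obtain ⟨h1, h2⟩ := hsrc y hy
    refine (hasMFDerivAt_comp_chart η (chart_mem_atlas ℂ x) h1 (hF _ h2.2)).congr_of_eventuallyEq ?_
    filter_upwards [e₀.open_source.mem_nhds hy] with y' hy'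
    exact (hV _ (hsrc y' hy').2.1).symm
  refine ⟨(e₀.symm.restrOpen (Metric.ball 0 r) Metric.isOpen_ball).symm, r, ?_, he0, hr, ?_, ?_⟩
  · rw [OpenPartialHomeomorph.symm_source]
    have := (e₀.symm.restrOpen (Metric.ball 0 r) Metric.isOpen_ball).map_source (x := 0) (by
      rw [OpenPartialHomeomorph.restrOpen_source]
      exact ⟨hrb (Metric.mem_ball_self hr), Metric.mem_ball_self hr⟩)
    have h3 : (e₀.symm.restrOpen (Metric.ball 0 r) Metric.isOpen_ball) 0 = x := by
      change e₀.symm 0 = x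
      rw [← he0, e₀.left_inv hxe]
    rwa [h3] at this
  · rw [OpenPartialHomeomorph.symm_target, OpenPartialHomeomorph.restrOpen_source]
    exact inter_eq_self_of_subset_right hrb
  · intro y hy
    refine hprim y ?_
    rw [OpenPartialHomeomorph.symm_source] at hy
    have := (e₀.symm.restrOpen (Metric.ball 0 r) Metric.isOpen_ball).symm.map_source hy
    rw [OpenPartialHomeomorph.symm_target, OpenPartialHomeomorph.restrOpen_source] at this
    have h4 := e₀.symm.map_source this.1
    have h5 := (e₀.symm.restrOpen (Metric.ball 0 r) Metric.isOpen_ball).right_inv hy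
    change e₀.symm (e₀ y) = y at h5
    change e₀.symm (e₀ y) ∈ e₀.source at h4
    rwa [h5] at h4

/-- Two primitives differ locally by a constant. -/
theorem IsPrimitiveOn.eventually_sub_eq {G G' : X → ℂ} {U U' : Set X} (hU : IsOpen U)
    (hU' : IsOpen U') (hG : IsPrimitiveOn η G U) (hG' : IsPrimitiveOn η G' U') {x : X}
    (hx : x ∈ U) (hx' : x ∈ U') : ∀ᶠ y in 𝓝 x, G y - G x = G' y - G' x := by
  set φ := chartAt ℂ x
  have hmd : φ.MDifferentiable 𝓘(ℂ, ℂ) 𝓘(ℂ, ℂ) := mdifferentiable_chart x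
  have hxφ : x ∈ φ.source := mem_chart_source ℂ x
  set W := φ.target ∩ φ.symm ⁻¹' (U ∩ U')
  have hWo : IsOpen W := φ.isOpen_inter_preimage_symm (hU.inter hU')
  have hxW : φ x ∈ W := ⟨φ.map_source hxφ, by simp only [mem_preimage, φ.left_inv hxφ]; exact ⟨hx, hx'⟩⟩
  obtain ⟨ρ, hρ, hball⟩ := Metric.isOpen_iff.1 hWo _ hxW
  have hd : ∀ z ∈ W, HasFDerivAt (fun z ↦ G (φ.symm z) - G' (φ.symm z)) (0 : ℂ →L[ℂ] ℂ) z := by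
    intro z hz
    have hs := (hmd.mdifferentiableAt_symm hz.1).hasMFDerivAt
    have h1 := ((hG _ hz.2.1).comp z hs).hasFDerivAt
    have h2 := ((hG' _ hz.2.2).comp z hs).hasFDerivAt
    exact (h1.sub h2).congr_fderiv (sub_self _)
  have hconst : ∀ z ∈ Metric.ball (φ x) ρ, G (φ.symm z) - G' (φ.symm z) = G x - G' x := by
    intro z hz
    have := (convex_ball (φ x) ρ).is_const_of_fderivWithin_eq_zero (𝕜 := ℂ)
      (f := fun z ↦ G (φ.symm z) - G' (φ.symm z))
      (fun z hz ↦ (hd z (hball hz)).differentiableAt.differentiableWithinAt)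
      (fun z hz ↦ ((hd z (hball hz)).hasFDerivWithinAt).fderivWithin
        (Metric.isOpen_ball.uniqueDiffWithinAt hz)) hz (Metric.mem_ball_self hρ)
    simpa only [φ.left_inv hxφ] using this
  have hev : ∀ᶠ y in 𝓝 x, φ y ∈ Metric.ball (φ x) ρ :=
    (φ.continuousAt hxφ).eventually_mem (Metric.ball_mem_nhds _ hρ)
  filter_upwards [hev, φ.open_source.mem_nhds hxφ] with y hy hyφ
  have := hconst _ hy
  rw [φ.left_inv hyφ] at this
  linear_combination this

variable {η}

/-- Developed maps can be tested on any primitive. -/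
theorem IsDevelopedBy.eventually {T : Type*} [TopologicalSpace T] {A : Set T} {c : T → X}
    {D : T → ℂ} (h : IsDevelopedBy η A c D) {a : T} (ha : a ∈ A) {U : Set X} {G : X → ℂ}
    (hU : IsOpen U) (haU : c a ∈ U) (hG : IsPrimitiveOn η G U) :
    ∀ᶠ s in 𝓝[A] a, G (c s) - G (c a) = D s - D a := by
  obtain ⟨U', G', hU', haU', hG', hev⟩ := h.2 a ha
  have h1 := IsPrimitiveOn.eventually_sub_eq η hU hU' hG hG' haU haU'
  filter_upwards [hev, (h.1 a ha).eventually h1] with s hs hs'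
  rw [hs', hs]

end OneForms

/-- Induction on a connected set: a property that is open and closed in the set and holds at one
point holds everywhere. -/
theorem forall_of_isPreconnected {T : Type*} [TopologicalSpace T] {A : Set T}
    (hA : IsPreconnected A) {P : T → Prop} {a : T} (ha : a ∈ A) (hPa : P a)
    (hopen : ∀ s ∈ A, P s → ∀ᶠ t in 𝓝[A] s, P t)
    (hclosed : ∀ s ∈ A, (∃ᶠ t in 𝓝[A] s, P t) → P s) : ∀ s ∈ A, P s := by
  have : PreconnectedSpace A := Subtype.preconnectedSpace hA
  have hcl : IsClopen {s : A | P s} := by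
    refine ⟨?_, ?_⟩
    · refine isOpen_compl_iff.1 (isOpen_iff_mem_nhds.2 fun s hs ↦ ?_)
      have h1 : ∀ᶠ t in 𝓝[A] (s : T), ¬ P t := by
        by_contra hcon
        exact hs (hclosed s s.2 hcon)
      rw [nhds_subtype_eq_comap_nhdsWithin]
      exact preimage_mem_comap h1
    · refine isOpen_iff_mem_nhds.2 fun s hs ↦ ?_
      rw [nhds_subtype_eq_comap_nhdsWithin]
      exact preimage_mem_comap (hopen s s.2 hs)
  have huniv := hcl.eq_univ ⟨⟨a, ha⟩, hPa⟩
  exact fun s hs ↦ (huniv ▸ mem_univ (⟨s, hs⟩ : A) : (⟨s, hs⟩ : A) ∈ {s : A | P s})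

/-! ### Maps with a prescribed development: uniqueness and extension -/

section OneForms
variable {X : Type u} [TopologicalSpace X] [ChartedSpace ℂ X] [IsManifold 𝓘(ℂ, ℂ) ω X]
  {η : HolomorphicOneForm X}

theorem IsDevelopedBy.mono {T : Type*} [TopologicalSpace T] {A B : Set T} {c : T → X}
    {D : T → ℂ} (h : IsDevelopedBy η A c D) (hB : B ⊆ A) : IsDevelopedBy η B c D :=
  ⟨h.1.mono hB, fun t ht ↦ by
    obtain ⟨U, G, hU, htU, hG, hev⟩ := h.2 t (hB ht)
    exact ⟨U, G, hU, htU, hG, hev.filter_mono (nhdsWithin_mono _ hB)⟩⟩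

theorem IsDevelopedBy.congr {T : Type*} [TopologicalSpace T] {A : Set T} {c c' : T → X}
    {D : T → ℂ} (h : IsDevelopedBy η A c D) (hc : EqOn c' c A) : IsDevelopedBy η A c' D :=
  ⟨h.1.congr hc, fun t ht ↦ by
    obtain ⟨U, G, hU, htU, hG, hev⟩ := h.2 t ht
    refine ⟨U, G, hU, by rwa [hc ht], hG, ?_⟩
    filter_upwards [hev, self_mem_nhdsWithin] with s hs hsA
    rw [hc hsA, hc ht, hs]⟩

theorem IsDevelopedBy.comp {T T' : Type*} [TopologicalSpace T] [TopologicalSpace T'] {A : Set T}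
    {B : Set T'} {c : T → X} {D : T → ℂ} (h : IsDevelopedBy η A c D) {f : T' → T} {D' : T' → ℂ}
    (hf : ContinuousOn f B) (hfB : MapsTo f B A)
    (hD : ∀ s ∈ B, ∀ t ∈ B, D (f s) - D (f t) = D' s - D' t) : IsDevelopedBy η B (c ∘ f) D' :=
  ⟨h.1.comp hf hfB, fun t ht ↦ by
    obtain ⟨U, G, hU, htU, hG, hev⟩ := h.2 (f t) (hfB ht)
    refine ⟨U, G, hU, htU, hG, ?_⟩
    filter_upwards [((hf t ht).tendsto_nhdsWithin hfB).eventually hev, self_mem_nhdsWithin]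
      with s hs hsB
    rw [← hD s hsB t ht, ← hs]; rfl⟩

/-- Agreement of increments is open by the definition of a development and closed by continuity, so
it spreads over a connected set. -/
theorem IsDevelopedBy.sub_eq {T : Type*} [TopologicalSpace T] {A : Set T} {c : T → X}
    {D : T → ℂ} (h : IsDevelopedBy η A c D) (hD : ContinuousOn D A) (hA : IsPreconnected A)
    {U : Set X} {G : X → ℂ} (hU : IsOpen U) (hG : IsPrimitiveOn η G U) (hcU : ∀ s ∈ A, c s ∈ U)
    {a s : T} (ha : a ∈ A) (hs : s ∈ A) : G (c s) - G (c a) = D s - D a := by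
  have hGc : ContinuousOn (fun s ↦ G (c s)) A := fun s hs ↦
    (hG _ (hcU s hs)).continuousAt.comp_continuousWithinAt (h.1 s hs)
  refine forall_of_isPreconnected hA (P := fun s ↦ G (c s) - G (c a) = D s - D a) ha (by simp)
    (fun s hs hP ↦ ?_) (fun s hs hP ↦ ?_) s hs
  · filter_upwards [h.eventually hs hU (hcU s hs) hG] with t ht
    linear_combination ht + hP
  · have h1 : ContinuousWithinAt (fun s ↦ G (c s) - G (c a) - (D s - D a)) A s :=
      ((hGc s hs).sub continuousWithinAt_const).sub ((hD s hs).sub continuousWithinAt_const)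
    have := isClosed_singleton (x := (0 : ℂ)).mem_of_frequently_of_tendsto
      (hP.mono fun t ht ↦ sub_eq_zero.2 ht) h1
    exact sub_eq_zero.1 this

variable {u : ℂ} {m : ℕ} {x : X} {e : OpenPartialHomeomorph X ℂ} {r : ℝ}

theorem IsFlatChart.closedBall_subset (he : IsFlatChart η u m x e r) {ρ : ℝ} (hρ : ρ < r) :
    Metric.closedBall 0 ρ ⊆ e.target := by
  rw [he.target_eq]; exact Metric.closedBall_subset_ball hρ

theorem IsFlatChart.symm_zero (he : IsFlatChart η u m x e r) : e.symm 0 = x := by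
  rw [← he.map_center, e.left_inv he.mem_source]

/-- A developed map that starts in a flat chart and whose development stays small does not leave
the chart. -/
theorem IsFlatChart.confined [T2Space X] (he : IsFlatChart η u m x e r) (hu : ‖u‖ = 1) (hm : m ≠ 0)
    {T : Type*} [TopologicalSpace T] {A : Set T} {c : T → X} {D : T → ℂ}
    (hc : IsDevelopedBy η A c D) (hD : ContinuousOn D A) (hA : IsPreconnected A) {a : T}
    (ha : a ∈ A) (hca : c a ∈ e.source) {ρ : ℝ} (hρ0 : 0 ≤ ρ) (hρ : ρ < r)
    (hb : ∀ s ∈ A, ‖u * e (c a) ^ m + (D s - D a)‖ ≤ ρ ^ m) :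
    ∀ s ∈ A, c s ∈ e.source ∧ u * e (c s) ^ m = u * e (c a) ^ m + (D s - D a) := by
  refine forall_of_isPreconnected hA ha ⟨hca, by simp⟩ (fun s hs hP ↦ ?_) (fun s hs hP ↦ ?_)
  · filter_upwards [hc.eventually hs e.open_source hP.1 he.primitive,
      (hc.1 s hs).eventually_mem (e.open_source.mem_nhds hP.1)] with t ht ht'
    exact ⟨ht', by linear_combination ht + hP.2⟩
  -- The bound on the development keeps `e` in the closed ball of radius `ρ < r`; its preimage is
  -- compact, so a limit of such points cannot leave the chart.
  · have hK : IsCompact (e.symm '' Metric.closedBall 0 ρ) :=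
      (isCompact_closedBall 0 ρ).image_of_continuousOn
        (e.continuousOn_symm.mono (he.closedBall_subset hρ))
    have hfr : ∃ᶠ t in 𝓝[A] s, (c t ∈ e.source ∧
        u * e (c t) ^ m = u * e (c a) ^ m + (D t - D a)) ∧ t ∈ A :=
      hP.and_eventually self_mem_nhdsWithin
    have hsK : c s ∈ e.symm '' Metric.closedBall 0 ρ := by
      refine hK.isClosed.mem_of_frequently_of_tendsto (hfr.mono fun t ht ↦ ?_) (hc.1 s hs)
      refine ⟨e (c t), ?_, e.left_inv ht.1.1⟩
      rw [mem_closedBall_zero_iff]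
      have := hb t ht.2
      rw [← ht.1.2, norm_mul, hu, one_mul, norm_pow] at this
      exact le_of_pow_le_pow_left₀ hm hρ0 this
    have hss : c s ∈ e.source := by
      obtain ⟨z, hz, hzs⟩ := hsK
      rw [← hzs]
      exact e.map_target (he.closedBall_subset hρ hz)
    refine ⟨hss, ?_⟩
    have h1 : ContinuousWithinAt
        (fun t ↦ u * e (c t) ^ m - (u * e (c a) ^ m + (D t - D a))) A s :=
      (continuousWithinAt_const.mul
        (((e.continuousAt hss).comp_continuousWithinAt (hc.1 s hs)).pow m)).sub
        (continuousWithinAt_const.add ((hD s hs).sub continuousWithinAt_const))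
    have := isClosed_singleton (x := (0 : ℂ)).mem_of_frequently_of_tendsto
      (hP.mono fun t ht ↦ sub_eq_zero.2 ht.2) h1
    exact sub_eq_zero.1 this

/-- Two maps with the same development that agree at one point agree everywhere, as long as one
of them avoids the zeros. -/
theorem IsDevelopedBy.eqOn [T2Space X] {T : Type*} [TopologicalSpace T] {A : Set T} {c c' : T → X}
    {D : T → ℂ} (hc : IsDevelopedBy η A c D) (hc' : IsDevelopedBy η A c' D)
    (hA : IsPreconnected A) {a : T} (ha : a ∈ A) (haa : c a = c' a)
    (hz : ∀ s ∈ A, c s ∉ zeros η) : ∀ s ∈ A, c s = c' s := by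
  refine forall_of_isPreconnected hA ha haa (fun s hs hP ↦ ?_) (fun s hs hP ↦ ?_)
  -- At a regular point the exponent is `1`, so the primitive is injective and equal developments
  -- give equal points.
  · obtain ⟨e, r, he⟩ := exists_isFlatChart η (one_ne_zero (α := ℂ)) (x := c s) (k := 0)
      (zeroOrder_eq_zero η (hz s hs))
    have hP' : c' s ∈ e.source := hP ▸ he.mem_source
    filter_upwards [hc.eventually hs e.open_source he.mem_source he.primitive,
      hc'.eventually hs e.open_source hP' he.primitive,
      (hc.1 s hs).eventually_mem (e.open_source.mem_nhds he.mem_source),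
      (hc'.1 s hs).eventually_mem (e.open_source.mem_nhds hP')] with t h1 h2 h3 h4
    refine e.injOn h3 h4 ?_
    rw [← hP] at h2
    simp only [zero_add, pow_one, one_mul] at h1 h2
    linear_combination h1 - h2
  · by_contra hne
    obtain ⟨V, V', hV, hV', hsV, hsV', hd⟩ := t2_separation hne
    obtain ⟨t, ht, ht1, ht2⟩ := (hP.and_eventually
      (((hc.1 s hs).eventually_mem (hV.mem_nhds hsV)).and
      ((hc'.1 s hs).eventually_mem (hV'.mem_nhds hsV')))).exists
    exact disjoint_left.1 hd ht1 (ht ▸ ht2)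

/-- A map from a convex subset of the plane that is developed by `z ↦ u z` has limits on the
closure. -/
theorem exists_tendsto_of_isDevelopedBy [T2Space X] [CompactSpace X] (hu : ‖u‖ = 1)
    (hfin : ∀ x : X, ∃ k : ℕ, zeroOrder η x = k) {A : Set ℂ} (hA : Convex ℝ A) {Φ : ℂ → X}
    (hΦ : IsDevelopedBy η A Φ (fun z ↦ u * z)) {z₀ : ℂ} (hz₀ : z₀ ∈ closure A) :
    ∃ q, Tendsto Φ (𝓝[A] z₀) (𝓝 q) := by
  have hne : (𝓝[A] z₀).NeBot := mem_closure_iff_nhdsWithin_neBot.1 hz₀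
  obtain ⟨q, hq⟩ := exists_clusterPt_of_compactSpace (map Φ (𝓝[A] z₀))
  refine ⟨q, ?_⟩
  obtain ⟨k, hk⟩ := hfin q
  obtain ⟨e, r, he⟩ := exists_isFlatChart η (norm_ne_zero_iff.1 (hu ▸ one_ne_zero)) hk
  -- Some value of `Φ` near `z₀` comes within `ε ^ m / 2` of the cluster point, measured by `e ^ m`.
  -- On the convex piece of `A` near `z₀` the development moves by at most `ε ^ m / 4`, so
  -- `confined` traps all values there.
  have hsmall : ∀ ε : ℝ, 0 < ε → ε < r → ∀ᶠ z in 𝓝[A] z₀, Φ z ∈ e.symm '' Metric.closedBall 0 ε := by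
    intro ε hε hεr
    set m := k + 1
    have hεm : 0 < ε ^ m := pow_pos hε m
    have hN : {y | y ∈ e.source ∧ ‖e y ^ m‖ < ε ^ m / 2} ∈ 𝓝 q := by
      refine inter_mem (e.open_source.mem_nhds he.mem_source) ?_
      have h1 : ContinuousAt (fun y ↦ ‖e y ^ m‖) q := ((e.continuousAt he.mem_source).pow m).norm
      have h2 : ‖e q ^ m‖ < ε ^ m / 2 := by
        rw [he.map_center, zero_pow k.succ_ne_zero, norm_zero]; positivity
      exact h1.eventually_lt_const h2
    have hev : ∀ᶠ z in 𝓝[A] z₀, z ∈ Metric.ball z₀ (ε ^ m / 8) :=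
      mem_nhdsWithin_of_mem_nhds (Metric.ball_mem_nhds _ (by positivity))
    have hfr : ∃ᶠ z in 𝓝[A] z₀, Φ z ∈ {y | y ∈ e.source ∧ ‖e y ^ m‖ < ε ^ m / 2} :=
      (clusterPt_iff_frequently.1 hq) _ hN
    obtain ⟨z₁, ⟨hz1s, hz1e⟩, hz1b, hz1A⟩ := (hfr.and_eventually (hev.and self_mem_nhdsWithin)).exists
    have hconf := he.confined hu k.succ_ne_zero
      (hΦ.mono (inter_subset_left (t := Metric.ball z₀ (ε ^ m / 8))))
      (by fun_prop) ((hA.inter (convex_ball _ _)).isPreconnected) (a := z₁) ⟨hz1A, hz1b⟩ hz1s hε.le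
      hεr (fun z hz ↦ by
        have h1 : ‖z - z₁‖ ≤ ε ^ m / 4 := by
          rw [← dist_eq_norm]
          have := dist_triangle_right z z₁ z₀
          have h2 := Metric.mem_ball.1 hz.2
          have h3 := Metric.mem_ball.1 hz1b
          linarith
        calc ‖u * e (Φ z₁) ^ m + (u * z - u * z₁)‖ ≤ ‖u * e (Φ z₁) ^ m‖ + ‖u * z - u * z₁‖ :=
              norm_add_le _ _
          _ = ‖e (Φ z₁) ^ m‖ + ‖z - z₁‖ := by rw [← mul_sub, norm_mul, norm_mul, hu, one_mul, one_mul]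
          _ ≤ ε ^ m := by linarith)
    filter_upwards [hev, self_mem_nhdsWithin] with z hz hzA
    obtain ⟨h1, h2⟩ := hconf z ⟨hzA, hz⟩
    refine ⟨e (Φ z), ?_, e.left_inv h1⟩
    rw [mem_closedBall_zero_iff]
    have h3 : ‖e (Φ z)‖ ^ m ≤ ε ^ m := by
      rw [← norm_pow, ← one_mul ‖e (Φ z) ^ m‖, ← hu, ← norm_mul, h2]
      have h1 : ‖z - z₁‖ ≤ ε ^ m / 4 := by
        rw [← dist_eq_norm]
        have := dist_triangle_right z z₁ z₀
        have h2 := Metric.mem_ball.1 hz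
        have h3 := Metric.mem_ball.1 hz1b
        linarith
      calc ‖u * e (Φ z₁) ^ m + (u * z - u * z₁)‖ ≤ ‖u * e (Φ z₁) ^ m‖ + ‖u * z - u * z₁‖ :=
            norm_add_le _ _
        _ = ‖e (Φ z₁) ^ m‖ + ‖z - z₁‖ := by rw [← mul_sub, norm_mul, norm_mul, hu, one_mul, one_mul]
        _ ≤ ε ^ m := by linarith
    exact le_of_pow_le_pow_left₀ k.succ_ne_zero hε.le h3
  intro N hN
  have h0t : (0 : ℂ) ∈ e.target := by rw [he.target_eq]; exact Metric.mem_ball_self he.pos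
  have hpre : e.symm ⁻¹' N ∈ 𝓝 (0 : ℂ) :=
    (e.symm.continuousAt h0t) (by rw [he.symm_zero]; exact hN)
  obtain ⟨ε, hε, hball⟩ := Metric.mem_nhds_iff.1 hpre
  rw [mem_map]
  filter_upwards [hsmall (min ε r / 2) (by have := he.pos; positivity)
    (by have := he.pos; have := min_le_right ε r; linarith)] with z hz
  obtain ⟨w, hw, hwz⟩ := hz
  change Φ z ∈ N
  rw [← hwz]
  refine hball ?_
  rw [mem_ball_zero_iff]
  rw [mem_closedBall_zero_iff] at hw
  have := min_le_left ε r
  linarith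

/-- A map from a convex subset of the plane that is developed by `z ↦ u z` extends to the closure,
with the same development. -/
theorem isDevelopedBy_extendFrom [T2Space X] [CompactSpace X] (hu : ‖u‖ = 1)
    (hfin : ∀ x : X, ∃ k : ℕ, zeroOrder η x = k) {A : Set ℂ} (hA : Convex ℝ A) {Φ : ℂ → X}
    (hΦ : IsDevelopedBy η A Φ (fun z ↦ u * z)) :
    IsDevelopedBy η (closure A) (extendFrom A Φ) (fun z ↦ u * z) := by
  have hcont : ContinuousOn (extendFrom A Φ) (closure A) := continuousOn_extendFrom subset_rfl
    fun z hz ↦ exists_tendsto_of_isDevelopedBy hu hfin hA hΦ hz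
  have hext : EqOn (extendFrom A Φ) Φ A := extendFrom_extends hΦ.1
  have hΦ' := hΦ.congr hext
  refine ⟨hcont, fun z₀ hz₀ ↦ ?_⟩
  obtain ⟨k, hk⟩ := hfin (extendFrom A Φ z₀)
  obtain ⟨e, r, he⟩ := exists_isFlatChart η (norm_ne_zero_iff.1 (hu ▸ one_ne_zero)) hk
  refine ⟨e.source, _, e.open_source, he.mem_source, he.primitive, ?_⟩
  obtain ⟨δ, hδ, hball⟩ := Metric.mem_nhdsWithin_iff.1
    ((hcont z₀ hz₀).eventually_mem (e.open_source.mem_nhds he.mem_source))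
  have hne : (A ∩ Metric.ball z₀ δ).Nonempty :=
    mem_closure_iff_nhds.1 hz₀ _ (Metric.ball_mem_nhds _ hδ) |>.mono fun _ h ↦ ⟨h.2, h.1⟩
  obtain ⟨a, ha⟩ := hne
  set G : X → ℂ := fun y ↦ u * e y ^ (k + 1)
  have hA' : ∀ z ∈ A ∩ Metric.ball z₀ δ,
      G (extendFrom A Φ z) - G (extendFrom A Φ a) = u * z - u * a := fun z hz ↦
    (hΦ'.mono inter_subset_left).sub_eq (by fun_prop)
      ((hA.inter (convex_ball _ _)).isPreconnected) e.open_source he.primitive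
      (fun s hs ↦ hball ⟨hs.2, subset_closure hs.1⟩) ha hz
  have hcl : ∀ z ∈ closure A ∩ Metric.ball z₀ δ,
      G (extendFrom A Φ z) - G (extendFrom A Φ a) - (u * z - u * a) = 0 := fun z hz ↦ by
    have hzs : extendFrom A Φ z ∈ e.source := hball ⟨hz.2, hz.1⟩
    have hn : (𝓝[A ∩ Metric.ball z₀ δ] z).NeBot := by
      rw [← mem_closure_iff_nhdsWithin_neBot, inter_comm]
      exact Metric.isOpen_ball.inter_closure ⟨hz.2, hz.1⟩
    have hsub : A ∩ Metric.ball z₀ δ ⊆ closure A := inter_subset_left.trans subset_closure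
    have hc : ContinuousWithinAt (fun z ↦
        G (extendFrom A Φ z) - G (extendFrom A Φ a) - (u * z - u * a)) (A ∩ Metric.ball z₀ δ) z :=
      (((he.primitive _ hzs).continuousAt.comp_continuousWithinAt
        ((hcont z hz.1).mono hsub)).sub continuousWithinAt_const).sub (by fun_prop)
    refine tendsto_nhds_unique hc (tendsto_const_nhds.congr' ?_)
    filter_upwards [self_mem_nhdsWithin] with w hw
    rw [hA' w hw, sub_self]
  filter_upwards [self_mem_nhdsWithin, mem_nhdsWithin_of_mem_nhds (Metric.ball_mem_nhds z₀ hδ)]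
    with z hz hzb
  have h1 := hcl z ⟨hz, hzb⟩
  have h2 := hcl z₀ ⟨hz₀, Metric.mem_ball_self hδ⟩
  linear_combination h1 - h2

end OneForms

/-! ### Closed cylinders, their edges and their corners -/

section OneForms

variable {X : Type u} [TopologicalSpace X] [ChartedSpace ℂ X] [IsManifold 𝓘(ℂ, ℂ) ω X]

/-- A cylinder `C` parametrized from one of its edges: `Ψ` is defined up to the boundary on
`0 ≤ σ Im z ≤ h`, where `σ = ±1`. -/
structure IsBand (η : HolomorphicOneForm X) (u : ℂ) (σ w h : ℝ) (Ψ : ℂ → X) (C : Set X) :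
    Prop where
  sign : σ = 1 ∨ σ = -1
  width_pos : 0 < w
  height_pos : 0 < h
  developed : IsDevelopedBy η {z : ℂ | 0 ≤ σ * z.im ∧ σ * z.im ≤ h} Ψ (fun z ↦ u * z)
  inj : ∀ z z' : ℂ, 0 < σ * z.im → σ * z.im < h → 0 < σ * z'.im → σ * z'.im < h →
      (Ψ z = Ψ z' ↔ ∃ m : ℤ, z' = z + m * w)
  image_eq : C = Ψ '' {z : ℂ | 0 < σ * z.im ∧ σ * z.im < h}
  disjoint_zeros : Disjoint C (zeros η)
  periodic : ∀ z : ℂ, 0 ≤ σ * z.im → σ * z.im ≤ h → Ψ (z + w) = Ψ z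

variable {η : HolomorphicOneForm X} {u : ℂ}

theorem convex_strip (h : ℝ) : Convex ℝ {z : ℂ | 0 < z.im ∧ z.im < h} :=
  (convex_Ioo 0 h).linear_preimage Complex.imLm

theorem closure_strip {h : ℝ} (hh : 0 < h) :
    closure {z : ℂ | 0 < z.im ∧ z.im < h} = {z : ℂ | 0 ≤ z.im ∧ z.im ≤ h} := by
  change closure (Complex.im ⁻¹' Ioo 0 h) = Complex.im ⁻¹' Icc 0 h
  rw [Complex.closure_preimage_im, closure_Ioo hh.ne]

/-- The parametrization extends to the closed strip, and its periodicity passes to the boundary. For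
`σ = -1` it is shifted by `h * I`, so that the upper edge becomes the real axis. -/
theorem IsCylinder.exists_isBand [T2Space X] [CompactSpace X] (hu : ‖u‖ = 1)
    (hfin : ∀ x : X, ∃ k : ℕ, zeroOrder η x = k) {C : Set X} (hC : IsCylinder η u C) {σ : ℝ}
    (hσ : σ = 1 ∨ σ = -1) : ∃ w h Ψ, IsBand η u σ w h Ψ C := by
  obtain ⟨w, h, Φ, hw, hh, hdev, hinj, himg, hdisj⟩ := hC
  set A := {z : ℂ | 0 < z.im ∧ z.im < h}
  have hdev' := isDevelopedBy_extendFrom hu hfin (convex_strip h) hdev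
  have hext : EqOn (extendFrom A Φ) Φ A := extendFrom_extends hdev.1
  have hper : EqOn (fun z ↦ extendFrom A Φ (z + w)) (extendFrom A Φ) (closure A) := by
    have hmem : ∀ z ∈ A, z + w ∈ A := fun z hz ↦ by simpa [A] using hz
    refine EqOn.of_subset_closure (s := A) (fun z hz ↦ ?_) ?_ hdev'.1 subset_closure subset_rfl
    · rw [hext hz, hext (hmem z hz)]
      exact ((hinj z (z + w) hz.1 hz.2 (hmem z hz).1 (hmem z hz).2).2 ⟨1, by simp⟩).symm
    · refine hdev'.1.comp (by fun_prop) fun z hz ↦ ?_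
      rw [closure_strip hh] at hz ⊢
      simpa using hz
  rw [closure_strip hh] at hdev' hper
  rcases hσ with rfl | rfl
  · refine ⟨w, h, extendFrom A Φ, .inl rfl, hw, hh, by simpa using hdev', ?_, ?_, hdisj, ?_⟩
    · intro z z' h1 h2 h3 h4
      simp only [one_mul] at h1 h2 h3 h4
      rw [hext ⟨h1, h2⟩, hext ⟨h3, h4⟩]
      exact hinj z z' h1 h2 h3 h4
    · simp only [one_mul]
      rw [himg]
      exact (image_congr hext).symm
    · intro z h1 h2
      simp only [one_mul] at h1 h2
      exact hper ⟨h1, h2⟩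
  · have him : ∀ z : ℂ, (z + h * Complex.I).im = z.im + h := fun z ↦ by simp
    refine ⟨w, h, fun z ↦ extendFrom A Φ (z + h * Complex.I), .inr rfl, hw, hh, ?_, ?_, ?_, hdisj, ?_⟩
    · refine hdev'.comp (f := fun z : ℂ ↦ z + h * Complex.I) (by fun_prop) (fun z hz ↦ ?_)
        (fun s _ t _ ↦ by ring)
      obtain ⟨h1, h2⟩ := hz
      refine ⟨?_, ?_⟩ <;> rw [him] <;> linarith
    · intro z z' h1 h2 h3 h4
      have e1 : z + h * Complex.I ∈ A := ⟨by rw [him]; linarith, by rw [him]; linarith⟩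
      have e2 : z' + h * Complex.I ∈ A := ⟨by rw [him]; linarith, by rw [him]; linarith⟩
      change extendFrom A Φ _ = extendFrom A Φ _ ↔ _
      rw [hext e1, hext e2, hinj _ _ e1.1 e1.2 e2.1 e2.2]
      refine exists_congr fun m ↦ ⟨fun hm ↦ by linear_combination hm, fun hm ↦ by rw [hm]; ring⟩
    · rw [himg]
      ext x
      constructor
      · rintro ⟨z, hz, rfl⟩
        refine ⟨z - h * Complex.I, ?_, ?_⟩
        · obtain ⟨h1, h2⟩ := hz
          constructor <;> simp <;> linarith
        · change extendFrom A Φ (z - h * Complex.I + h * Complex.I) = _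
          rw [sub_add_cancel, hext hz]
      · rintro ⟨z, ⟨h1, h2⟩, rfl⟩
        have e1 : z + h * Complex.I ∈ A := ⟨by rw [him]; linarith, by rw [him]; linarith⟩
        exact ⟨_, e1, (hext e1).symm⟩
    · intro z h1 h2
      have e1 : z + h * Complex.I ∈ {z : ℂ | 0 ≤ z.im ∧ z.im ≤ h} :=
        ⟨by rw [him]; linarith, by rw [him]; linarith⟩
      have := hper e1
      change extendFrom A Φ (z + w + h * Complex.I) = _
      rw [← this, add_right_comm]

/-- A map developed by `z ↦ u z` near a point is open at that point, away from the zeros. -/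
theorem IsDevelopedBy.image_mem_nhds (hu : u ≠ 0) {A : Set ℂ} {Φ : ℂ → X}
    (hΦ : IsDevelopedBy η A Φ (fun z ↦ u * z)) {z : ℂ} (hA : A ∈ 𝓝 z) (hz : Φ z ∉ zeros η)
    {N : Set ℂ} (hN : N ∈ 𝓝 z) : Φ '' N ∈ 𝓝 (Φ z) := by
  obtain ⟨e, r, he⟩ := exists_isFlatChart η hu (x := Φ z) (k := 0) (zeroOrder_eq_zero η hz)
  have hzA : z ∈ A := mem_of_mem_nhds hA
  have h1 := hΦ.eventually hzA e.open_source he.mem_source he.primitive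
  have h2 := (hΦ.1 z hzA).eventually_mem (e.open_source.mem_nhds he.mem_source)
  rw [nhdsWithin_eq_nhds.2 hA] at h1 h2
  obtain ⟨δ, hδ, hball⟩ := Metric.mem_nhds_iff.1 (h1.and (h2.and hN))
  have h3 : ∀ᶠ y in 𝓝 (Φ z), ‖e y‖ < δ := by
    have h4 : ContinuousAt (fun y ↦ ‖e y‖) (Φ z) := (e.continuousAt he.mem_source).norm
    exact h4.eventually_lt_const (by simpa only [he.map_center, norm_zero] using hδ)
  filter_upwards [h3, e.open_source.mem_nhds he.mem_source] with y hy hys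
  obtain ⟨g1, g2, g3⟩ := hball (show z + e y ∈ Metric.ball z δ by simpa using hy)
  refine ⟨z + e y, g3, e.injOn g2 hys ?_⟩
  rw [he.map_center] at g1
  simp only [zero_add, pow_one, mul_zero, sub_zero] at g1
  exact mul_left_cancel₀ hu (by linear_combination g1)

variable {σ w h : ℝ} {Ψ : ℂ → X} {C : Set X}

theorem IsBand.sign_mul_self (hC : IsBand η u σ w h Ψ C) : σ * σ = 1 := by
  rcases hC.sign with rfl | rfl <;> norm_num

theorem isOpen_strip (σ a b : ℝ) : IsOpen {z : ℂ | a < σ * z.im ∧ σ * z.im < b} :=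
  (isOpen_Ioo (a := a) (b := b)).preimage (f := fun z : ℂ ↦ σ * z.im) (by fun_prop)

theorem IsBand.mem_of_mem_interior (hC : IsBand η u σ w h Ψ C) {z : ℂ} (h1 : 0 < σ * z.im)
    (h2 : σ * z.im < h) : Ψ z ∈ C := by
  rw [hC.image_eq]; exact ⟨z, ⟨h1, h2⟩, rfl⟩

theorem IsBand.image_mem_nhds (hC : IsBand η u σ w h Ψ C) (hu : u ≠ 0) {z : ℂ}
    (h1 : 0 < σ * z.im) (h2 : σ * z.im < h) {N : Set ℂ} (hN : N ∈ 𝓝 z) : Ψ '' N ∈ 𝓝 (Ψ z) := by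
  refine hC.developed.image_mem_nhds hu ?_
    (disjoint_left.1 hC.disjoint_zeros (hC.mem_of_mem_interior h1 h2)) hN
  exact mem_of_superset ((isOpen_strip _ _ _).mem_nhds (show z ∈ {z : ℂ | _ ∧ _} from ⟨h1, h2⟩))
    fun z hz ↦ ⟨hz.1.le, hz.2.le⟩

theorem IsBand.isOpen (hC : IsBand η u σ w h Ψ C) (hu : u ≠ 0) : IsOpen C := by
  rw [isOpen_iff_mem_nhds]
  intro x hx
  rw [hC.image_eq] at hx ⊢
  obtain ⟨z, ⟨h1, h2⟩, rfl⟩ := hx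
  exact hC.image_mem_nhds hu h1 h2 ((isOpen_strip _ _ _).mem_nhds ⟨h1, h2⟩)

theorem IsBand.tendsto_edge (hC : IsBand η u σ w h Ψ C) (x : ℝ) :
    Tendsto (fun y : ℝ ↦ Ψ (x + σ * y * Complex.I)) (𝓝[>] 0) (𝓝 (Ψ x)) := by
  have h0 : (x : ℂ) ∈ {z : ℂ | 0 ≤ σ * z.im ∧ σ * z.im ≤ h} := by
    simp [hC.height_pos.le]
  refine (hC.developed.1 x h0).tendsto.comp (tendsto_nhdsWithin_iff.2 ⟨?_, ?_⟩)
  · refine Tendsto.mono_left ?_ nhdsWithin_le_nhds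
    have : Continuous fun y : ℝ ↦ (x : ℂ) + σ * y * Complex.I := by fun_prop
    simpa using this.tendsto 0
  · filter_upwards [Ioo_mem_nhdsGT hC.height_pos] with y hy
    have : σ * ((x : ℂ) + σ * y * Complex.I).im = y := by
      simp [← mul_assoc, hC.sign_mul_self]
    exact ⟨by rw [this]; exact hy.1.le, by rw [this]; exact hy.2.le⟩

/-- Every edge of every cylinder of a completely periodic direction contains a zero. -/
theorem IsBand.exists_zero [T2Space X] [CompactSpace X] (hu : ‖u‖ = 1)
    (hfin : ∀ x : X, ∃ k : ℕ, zeroOrder η x = k) (hC : IsBand η u σ w h Ψ C) {𝒞 : Set (Set X)}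
    (hcyl : ∀ C ∈ 𝒞, IsCylinder η u C) (hdisj : 𝒞.PairwiseDisjoint id) (hC𝒞 : C ∈ 𝒞)
    (hcov : ∀ x : X, x ∉ zeros η → x ∉ ⋃₀ 𝒞 → ∃ L, IsSaddleConnection η u L ∧ x ∈ L) :
    ∃ x : ℝ, Ψ x ∈ zeros η := by
  by_contra! hno
  have hu0 : u ≠ 0 := norm_ne_zero_iff.1 (hu ▸ one_ne_zero)
  by_cases hq : Ψ (0 : ℝ) ∈ ⋃₀ 𝒞
  · obtain ⟨C', hC', hqC'⟩ := hq
    have him : ∀ y : ℝ, σ * (((0 : ℝ) : ℂ) + σ * y * Complex.I).im = y := fun y ↦ by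
      simp [← mul_assoc, hC.sign_mul_self]
    have hlim := hC.tendsto_edge 0
    obtain ⟨w', h', Ψ', hB'⟩ := (hcyl C' hC').exists_isBand hu hfin (.inl rfl)
    -- The cylinder through the edge point is open, so it contains points of `C` near the edge.
    have hCC' : C = C' := by
      by_contra hne
      obtain ⟨y, hy1, hy2⟩ := ((hlim.eventually_mem ((hB'.isOpen hu0).mem_nhds hqC')).and
        (Ioo_mem_nhdsGT hC.height_pos)).exists
      refine disjoint_left.1 (hdisj hC𝒞 hC' hne) (hC.mem_of_mem_interior ?_ ?_) hy1
      · rw [him]; exact hy2.1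
      · rw [him]; exact hy2.2
    have hq2 : Ψ (0 : ℝ) ∈ C := hCC' ▸ hqC'
    rw [hC.image_eq] at hq2
    obtain ⟨z', ⟨h1, h2⟩, hz'⟩ := hq2
    -- If the edge point were also interior, of height `σ * z'.im`, then points close to the edge
    -- would have a second preimage of height above half of that. The identifications preserve
    -- height, a contradiction.
    have hN : {z : ℂ | σ * z'.im / 2 < σ * z.im ∧ σ * z.im < h} ∈ 𝓝 z' := by
      refine (isOpen_strip _ _ _).mem_nhds ⟨?_, h2⟩
      linarith
    have hN' := hC.image_mem_nhds hu0 h1 h2 hN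
    rw [hz'] at hN'
    obtain ⟨y, ⟨z, ⟨hz1, hz2⟩, hzy⟩, hy1, hy2⟩ := ((hlim.eventually_mem hN').and
      (Ioo_mem_nhdsGT (half_pos h1))).exists
    obtain ⟨m, hm⟩ := (hC.inj z _ (by linarith) hz2 (by rw [him]; exact hy1)
      (by rw [him]; linarith)).1 hzy
    have := him y
    rw [hm] at this
    simp at this
    linarith
  -- Otherwise the edge runs along a saddle connection and, by uniqueness of continuation, reaches
  -- the zero at its end.
  · obtain ⟨L, ⟨l, c, hl, hdev, -, hcl, rfl, -⟩, t₀, ht₀, hcq⟩ := hcov _ (hno 0) hq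
    have hb : IsDevelopedBy η (Icc t₀ l) (Ψ ∘ fun t : ℝ ↦ ((t - t₀ : ℝ) : ℂ)) (fun t ↦ u * t) := by
      refine hC.developed.comp (by fun_prop) (fun t _ ↦ ?_) (fun s _ t _ ↦ by push_cast; ring)
      simp [hC.height_pos.le]
    have := hb.eqOn (hdev.mono (Icc_subset_Icc_left ht₀.1.le)) isPreconnected_Icc
      (left_mem_Icc.2 ht₀.2.le) (by simp [hcq]) (fun s _ ↦ hno _) l (right_mem_Icc.2 ht₀.2.le)
    exact hno _ (this ▸ hcl)

/-- The parametrization `Ψ` sends the half disc at the edge point `x₀` to the half-plane sector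
with index `ξ` of a flat chart `e` centred at a zero. -/
def IsCorner (σ : ℝ) (Ψ : ℂ → X) (x₀ : ℝ) (e : OpenPartialHomeomorph X ℂ) (m : ℕ) (ξ : ℂ) : Prop :=
  ∀ᶠ ρ : ℝ in 𝓝[>] 0, ∀ α ∈ Icc 0 Real.pi,
    Ψ (x₀ + ρ ^ m * Complex.exp (σ * α * Complex.I)) ∈ e.source ∧
    e (Ψ (x₀ + ρ ^ m * Complex.exp (σ * α * Complex.I))) =
      ξ * (ρ * Complex.exp (σ * α * Complex.I / m))

theorem IsBand.mul_im_exp (hC : IsBand η u σ w h Ψ C) (x₀ ρ α : ℝ) (m : ℕ) :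
    σ * ((x₀ : ℂ) + ρ ^ m * Complex.exp (σ * α * Complex.I)).im = ρ ^ m * Real.sin α := by
  have h1 : (x₀ : ℂ) + ρ ^ m * Complex.exp (σ * α * Complex.I) =
      ((x₀ + ρ ^ m * Real.cos (σ * α) : ℝ) : ℂ) +
        ((ρ ^ m * Real.sin (σ * α) : ℝ) : ℂ) * Complex.I := by
    rw [show (σ * α * Complex.I : ℂ) = ((σ * α : ℝ) : ℂ) * Complex.I by push_cast; ring,
      Complex.exp_mul_I]
    push_cast
    ring
  rw [h1, Complex.add_im, Complex.ofReal_im, Complex.im_ofReal_mul, Complex.I_im]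
  rcases hC.sign with rfl | rfl <;> simp

/-- Along the half disc the chart coordinate and `ρ * exp (iσα / m)` have the same `m`-th power, so
their ratio is a constant root of unity. Writing the radius as `ρ ^ m` avoids choosing a branch of
the root. -/
theorem IsBand.exists_isCorner (hu : u ≠ 0) (hC : IsBand η u σ w h Ψ C) {x₀ : ℝ} {p : X} {m : ℕ}
    (hm : m ≠ 0) {e : OpenPartialHomeomorph X ℂ} {r : ℝ} (he : IsFlatChart η u m p e r)
    (hx₀ : Ψ x₀ = p) : ∃ ξ : ℂ, ξ ^ m = 1 ∧ IsCorner σ Ψ x₀ e m ξ := by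
  have h0 : (x₀ : ℂ) ∈ {z : ℂ | 0 ≤ σ * z.im ∧ σ * z.im ≤ h} := by
    simp [hC.height_pos.le]
  have hs : Ψ x₀ ∈ e.source := hx₀ ▸ he.mem_source
  obtain ⟨δ₀, hδ₀, hball⟩ := Metric.mem_nhdsWithin_iff.1
    ((hC.developed.eventually h0 e.open_source hs he.primitive).and
      ((hC.developed.1 _ h0).eventually_mem (e.open_source.mem_nhds hs)))
  -- The bound `1` gives `ρ ^ m ≤ ρ`.
  set δ := min 1 (min δ₀ h)
  have hδ : 0 < δ := lt_min one_pos (lt_min hδ₀ hC.height_pos)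
  set f : ℝ × ℝ → ℂ := fun a ↦ x₀ + a.1 ^ m * Complex.exp (σ * a.2 * Complex.I)
  set A : Set (ℝ × ℝ) := Ioo 0 δ ×ˢ Icc 0 Real.pi
  have hpow : ∀ ρ ∈ Ioo 0 δ, 0 < ρ ^ m ∧ ρ ^ m < δ₀ ∧ ρ ^ m < h := by
    intro ρ hρ
    have h1 : ρ < 1 := hρ.2.trans_le (min_le_left _ _)
    have h2 : ρ < min δ₀ h := hρ.2.trans_le (min_le_right _ _)
    have h3 : ρ ^ m ≤ ρ := pow_le_of_le_one hρ.1.le h1.le hm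
    exact ⟨pow_pos hρ.1 m, h3.trans_lt (h2.trans_le (min_le_left _ _)),
      h3.trans_lt (h2.trans_le (min_le_right _ _))⟩
  have hfA : ∀ a ∈ A, f a ∈ Metric.ball (x₀ : ℂ) δ₀ ∩ {z : ℂ | 0 ≤ σ * z.im ∧ σ * z.im ≤ h} := by
    rintro ⟨ρ, α⟩ ⟨hρ, hα⟩
    obtain ⟨g1, g2, g3⟩ := hpow ρ hρ
    refine ⟨?_, ?_⟩
    · rw [mem_ball_iff_norm]
      simp only [f, add_sub_cancel_left, norm_mul, norm_pow, Complex.norm_real, Real.norm_eq_abs]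
      rw [show (σ * α * Complex.I : ℂ) = ((σ * α : ℝ) : ℂ) * Complex.I by push_cast; ring,
        Complex.norm_exp_ofReal_mul_I, mul_one, abs_of_pos hρ.1]
      exact g2
    · have h5 := Real.sin_nonneg_of_mem_Icc hα
      have h6 := Real.sin_le_one α
      change 0 ≤ σ * (f (ρ, α)).im ∧ σ * (f (ρ, α)).im ≤ h
      rw [show σ * (f (ρ, α)).im = ρ ^ m * Real.sin α from hC.mul_im_exp x₀ ρ α m]
      exact ⟨by positivity, by nlinarith⟩
  have hfc : Continuous f := by fun_prop
  have hmC : (m : ℂ) ≠ 0 := Nat.cast_ne_zero.2 hm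
  obtain ⟨ξ, hξ, hξA⟩ := exists_root_mul_eq (A := A) (m := m) (t := fun a ↦ e (Ψ (f a)))
    (γ := fun a ↦ (a.1 : ℂ) * Complex.exp (σ * a.2 * Complex.I / m))
    ((convex_Ioo 0 δ).isPreconnected.prod (convex_Icc 0 Real.pi).isPreconnected)
    ⟨(δ / 2, 0), ⟨by simp [hδ], by simp [hδ]⟩, by simp [Real.pi_pos.le]⟩
    (e.continuousOn.comp (hC.developed.1.comp hfc.continuousOn fun a ha ↦ (hfA a ha).2)
      fun a ha ↦ (hball (hfA a ha)).2)
    (by fun_prop) hm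
    (fun a ha ↦ mul_ne_zero (Complex.ofReal_ne_zero.2 ha.1.1.ne') (Complex.exp_ne_zero _))
    (fun a ha ↦ by
      have h1 := (hball (hfA a ha)).1
      simp only [hx₀, he.map_center, zero_pow hm, mul_zero, sub_zero] at h1
      have h2 : e (Ψ (f a)) ^ m = f a - x₀ := mul_left_cancel₀ hu (by linear_combination h1)
      rw [h2, mul_pow, ← Complex.exp_nat_mul, mul_div_cancel₀ _ hmC]
      simp [f])
  refine ⟨ξ, hξ, ?_⟩
  filter_upwards [Ioo_mem_nhdsGT hδ] with ρ hρ α hα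
  have ha : (ρ, α) ∈ A := ⟨hρ, hα⟩
  exact ⟨(hball (hfA _ ha)).2, hξA _ ha⟩

end OneForms

/-! ### Rays, separatrices and the number of cylinders -/

section OneForms

variable {X : Type u} [TopologicalSpace X] [ChartedSpace ℂ X] [IsManifold 𝓘(ℂ, ℂ) ω X]
variable {η : HolomorphicOneForm X} {u : ℂ}

theorem eventually_pow_lt {m : ℕ} (hm : m ≠ 0) {ε : ℝ} (hε : 0 < ε) :
    ∀ᶠ ρ : ℝ in 𝓝[>] 0, 0 < ρ ^ m ∧ ρ ^ m < ε := by
  have h1 : Tendsto (fun ρ : ℝ ↦ ρ ^ m) (𝓝[>] 0) (𝓝 0) := by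
    have : Continuous fun ρ : ℝ ↦ ρ ^ m := by fun_prop
    simpa [zero_pow hm] using (this.tendsto 0).mono_left nhdsWithin_le_nhds
  filter_upwards [h1.eventually_lt_const hε, self_mem_nhdsWithin] with ρ h2 h3
  exact ⟨pow_pos h3 m, h2⟩

/-- The chart is injective and sees the same point at angle `π / 2` from both corners. Hence two
cylinders in one sector overlap. -/
theorem IsCorner.exists_eq {σ w h w' h' : ℝ} {Ψ Ψ' : ℂ → X} {C C' : Set X}
    (hC : IsBand η u σ w h Ψ C) (hC' : IsBand η u σ w' h' Ψ' C') {x₀ x₀' : ℝ}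
    {e : OpenPartialHomeomorph X ℂ} {m : ℕ} (hm : m ≠ 0) {ξ : ℂ} (hc : IsCorner σ Ψ x₀ e m ξ)
    (hc' : IsCorner σ Ψ' x₀' e m ξ) : ∃ ζ : ℂ, 0 < σ * ζ.im ∧ σ * ζ.im < h ∧ σ * ζ.im < h' ∧
      Ψ (x₀ + ζ) = Ψ' (x₀' + ζ) := by
  obtain ⟨ρ, h1, h2, h3, h4⟩ := (hc.and (hc'.and ((eventually_pow_lt hm hC.height_pos).and
    (eventually_pow_lt hm hC'.height_pos)))).exists
  have hα : Real.pi / 2 ∈ Icc 0 Real.pi := ⟨by positivity, by linarith [Real.pi_pos]⟩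
  obtain ⟨g1, g2⟩ := h1 _ hα
  obtain ⟨g3, g4⟩ := h2 _ hα
  have him := hC.mul_im_exp 0 ρ (Real.pi / 2) m
  rw [Complex.ofReal_zero, zero_add, Real.sin_pi_div_two, mul_one] at him
  exact ⟨_, him ▸ h3.1, him ▸ h3.2, him ▸ h4.2, e.injOn g1 g3 (g2.trans g4.symm)⟩

/-- A unit speed geodesic arc in direction `u` that leaves the centre of a flat chart `e` along the
outgoing ray of index `ξ` and ends at the first zero it meets. -/
structure IsSeparatrix (η : HolomorphicOneForm X) (u : ℂ) (l : ℝ) (c : ℝ → X)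
    (e : OpenPartialHomeomorph X ℂ) (m : ℕ) (ξ : ℂ) : Prop where
  pos : 0 < l
  developed : IsDevelopedBy η (Icc 0 l) c (fun t ↦ u * t)
  end_mem : c l ∈ zeros η
  interior : ∀ s ∈ Ioo 0 l, c s ∉ zeros η
  germ : ∀ᶠ ρ : ℝ in 𝓝[>] 0, c (ρ ^ m) ∈ e.source ∧ e (c (ρ ^ m)) = ξ * ρ

variable {e : OpenPartialHomeomorph X ℂ} {m : ℕ} {ξ : ℂ} {l l' : ℝ} {c c' : ℝ → X}

/-- The arcs agree near the centre of the chart, and continuation is unique as long as no zero is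
met. -/
theorem IsSeparatrix.eq_of_lt [T2Space X] (hm : m ≠ 0) (hc : IsSeparatrix η u l c e m ξ)
    (hc' : IsSeparatrix η u l' c' e m ξ) (hl : l ≤ l') : ∀ s ∈ Ioo 0 l, c s = c' s := by
  obtain ⟨ρ, h1, h2, h3⟩ := (hc.germ.and (hc'.germ.and (eventually_pow_lt hm hc.pos))).exists
  exact (hc.developed.mono Ioo_subset_Icc_self).eqOn (hc'.developed.mono
    (Ioo_subset_Icc_self.trans (Icc_subset_Icc_right hl))) isPreconnected_Ioo h3
    (e.injOn h1.1 h2.1 (h1.2.trans h2.2.symm)) hc.interior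

/-- A longer arc `c'` would pass at time `l` through the zero that ends `c`. -/
theorem IsSeparatrix.length_le [T2Space X] (hm : m ≠ 0) (hc : IsSeparatrix η u l c e m ξ)
    (hc' : IsSeparatrix η u l' c' e m ξ) : l' ≤ l := by
  by_contra! hl
  have h1 := hc.eq_of_lt hm hc' hl.le
  have hmid : l / 2 ∈ Ioc 0 l := ⟨half_pos hc.pos, by linarith [hc.pos]⟩
  have hmid' : l / 2 ∈ Ioo 0 l := ⟨half_pos hc.pos, by linarith [hc.pos]⟩
  have h2 := (hc'.developed.mono (Ioc_subset_Icc_self.trans (Icc_subset_Icc_right hl.le))).eqOn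
    (hc.developed.mono Ioc_subset_Icc_self) isPreconnected_Ioc hmid (h1 _ hmid').symm
    (fun s hs ↦ hc'.interior s ⟨hs.1, hs.2.trans_lt hl⟩) l (right_mem_Ioc.2 hc.pos)
  exact hc'.interior l ⟨hc.pos, hl⟩ (h2 ▸ hc.end_mem)

theorem IsSeparatrix.length_eq [T2Space X] (hm : m ≠ 0) (hc : IsSeparatrix η u l c e m ξ)
    (hc' : IsSeparatrix η u l' c' e m ξ) : l = l' :=
  le_antisymm (hc'.length_le hm hc) (hc.length_le hm hc')

/-- In a flat chart at the starting zero, the coordinate at time `ρ ^ m` has `m`-th power `ρ ^ m`,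
so it follows a single root of unity. This attaches each saddle connection to one of finitely many
rays. -/
theorem IsSaddleConnection.exists_isSeparatrix (hu : u ≠ 0) {L : Set X}
    (hL : IsSaddleConnection η u L) : ∃ p ∈ zeros η, ∀ (m : ℕ) (e : OpenPartialHomeomorph X ℂ)
      (r : ℝ), m ≠ 0 → IsFlatChart η u m p e r → ∃ ξ l c, ξ ^ m = 1 ∧ IsSeparatrix η u l c e m ξ ∧
        L = c '' Ioo 0 l := by
  obtain ⟨l, c, hl, hdev, h0, h1, hLc, hd⟩ := hL
  refine ⟨c 0, h0, fun m e r hm he ↦ ?_⟩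
  have h00 : (0 : ℝ) ∈ Icc 0 l := left_mem_Icc.2 hl.le
  have hs : c 0 ∈ e.source := he.mem_source
  obtain ⟨δ₀, hδ₀, hball⟩ := Metric.mem_nhdsWithin_iff.1
    ((hdev.eventually h00 e.open_source hs he.primitive).and
      ((hdev.1 _ h00).eventually_mem (e.open_source.mem_nhds hs)))
  set δ := min 1 (min δ₀ l)
  have hδ : 0 < δ := lt_min one_pos (lt_min hδ₀ hl)
  have hA : ∀ ρ ∈ Ioo 0 δ, ρ ^ m ∈ Metric.ball 0 δ₀ ∩ Icc 0 l := by
    intro ρ hρ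
    have h1 : ρ < 1 := hρ.2.trans_le (min_le_left _ _)
    have h2 : ρ < min δ₀ l := hρ.2.trans_le (min_le_right _ _)
    have h3 : ρ ^ m ≤ ρ := pow_le_of_le_one hρ.1.le h1.le hm
    have h4 : 0 < ρ ^ m := pow_pos hρ.1 m
    refine ⟨?_, h4.le, h3.trans (h2.trans_le (min_le_right _ _)).le⟩
    rw [mem_ball_zero_iff, Real.norm_eq_abs, abs_of_pos h4]
    exact h3.trans_lt (h2.trans_le (min_le_left _ _))
  obtain ⟨ξ, hξ, hξA⟩ := exists_root_mul_eq (A := Ioo 0 δ) (m := m) (t := fun ρ ↦ e (c (ρ ^ m)))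
    (γ := fun ρ ↦ (ρ : ℂ)) isPreconnected_Ioo ⟨δ / 2, by simp [hδ], by simp [hδ]⟩
    (e.continuousOn.comp (hdev.1.comp (by fun_prop) fun a ha ↦ (hA a ha).2)
      fun a ha ↦ (hball (hA a ha)).2) (by fun_prop) hm
    (fun a ha ↦ Complex.ofReal_ne_zero.2 ha.1.ne')
    (fun a ha ↦ by
      have h1 := (hball (hA a ha)).1
      simp only [he.map_center, zero_pow hm, mul_zero, sub_zero, Complex.ofReal_zero] at h1
      have h2 := mul_left_cancel₀ hu h1
      rw [h2]; push_cast; rfl)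
  refine ⟨ξ, l, c, hξ, ⟨hl, hdev, h1, fun s hs ↦ ?_, ?_⟩, hLc⟩
  · exact disjoint_left.1 hd (hLc ▸ mem_image_of_mem c hs)
  · filter_upwards [Ioo_mem_nhdsGT hδ] with ρ hρ
    exact ⟨(hball (hA ρ hρ)).2, hξA ρ hρ⟩

/-- Flat charts at all the zeros of `η`, which are the points `P i` of order `k i`. -/
structure IsFlatAtlas (η : HolomorphicOneForm X) (u : ℂ) {n : ℕ} (k : Fin n → ℕ) (P : Fin n → X)
    (e : Fin n → OpenPartialHomeomorph X ℂ) : Prop where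
  zeros_eq : zeros η = range P
  flat : ∀ i, ∃ r, IsFlatChart η u (k i + 1) (P i) (e i) r

/-- The outgoing rays at the zeros. -/
abbrev Ray {n : ℕ} (k : Fin n → ℕ) : Type := Σ i : Fin n, rootsOfUnity (k i + 1) ℂ

theorem card_ray {n : ℕ} (k : Fin n → ℕ) : Nat.card (Ray k) = ∑ i, (k i + 1) := by
  rw [Nat.card_sigma]
  exact Finset.sum_congr rfl fun i _ ↦ Complex.card_rootsOfUnity _

variable {n : ℕ} {k : Fin n → ℕ} {P : Fin n → X} {E : Fin n → OpenPartialHomeomorph X ℂ}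

theorem exists_rootsOfUnity {m : ℕ} (hm : m ≠ 0) {ξ : ℂ} (h : ξ ^ m = 1) :
    ∃ ζ : rootsOfUnity m ℂ, ((ζ : ℂˣ) : ℂ) = ξ := by
  have : NeZero m := ⟨hm⟩
  exact ⟨rootsOfUnity.mkOfPowEq ξ h, rfl⟩

/-- There are finitely many saddle connections in a given direction. -/
theorem finite_saddleConnections [T2Space X] (hu : u ≠ 0) (hE : IsFlatAtlas η u k P E) :
    {L | IsSaddleConnection η u L}.Finite := by
  have key : ∀ L : {L | IsSaddleConnection η u L}, ∃ a : Ray k, ∃ l c,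
      IsSeparatrix η u l c (E a.1) (k a.1 + 1) (a.2 : ℂˣ) ∧ (L : Set X) = c '' Ioo 0 l := by
    rintro ⟨L, hL⟩
    obtain ⟨p, hp, H⟩ := IsSaddleConnection.exists_isSeparatrix hu hL
    rw [hE.zeros_eq] at hp
    obtain ⟨i, rfl⟩ := hp
    obtain ⟨r, hr⟩ := hE.flat i
    obtain ⟨ξ, l, c, hξ, hs, hLc⟩ := H _ _ r (k i).succ_ne_zero hr
    obtain ⟨ζ, rfl⟩ := exists_rootsOfUnity (k i).succ_ne_zero hξ
    exact ⟨⟨i, ζ⟩, l, c, hs, hLc⟩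
  choose a l c hs hL using key
  refine Finite.of_injective (α := {L | IsSaddleConnection η u L}) a ?_
  intro L L' haa
  have h1 := hs L
  have h2 := hs L'
  rw [← haa] at h2
  have hl := h1.length_eq (Nat.succ_ne_zero _) h2
  apply Subtype.ext
  rw [hL L, hL L', ← hl]
  exact image_congr (h1.eq_of_lt (Nat.succ_ne_zero _) h2 hl.le)

/-- `C` occupies the half-plane sector with index `a` at a zero, on the side `σ`. -/
def HasCorner (η : HolomorphicOneForm X) (u : ℂ) (k : Fin n → ℕ) (P : Fin n → X)
    (E : Fin n → OpenPartialHomeomorph X ℂ) (σ : ℝ) (C : Set X) (a : Ray k) : Prop :=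
  ∃ (w h : ℝ) (Ψ : ℂ → X) (x₀ : ℝ), IsBand η u σ w h Ψ C ∧ Ψ x₀ = P a.1 ∧
    IsCorner σ Ψ x₀ (E a.1) (k a.1 + 1) (a.2 : ℂˣ)

theorem HasCorner.eq {σ : ℝ} {C C' : Set X} {a : Ray k} (h : HasCorner η u k P E σ C a)
    (h' : HasCorner η u k P E σ C' a) {𝒞 : Set (Set X)} (hdisj : 𝒞.PairwiseDisjoint id)
    (hC : C ∈ 𝒞) (hC' : C' ∈ 𝒞) : C = C' := by
  obtain ⟨w, h, Ψ, x₀, hB, -, hc⟩ := h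
  obtain ⟨w', h', Ψ', x₀', hB', -, hc'⟩ := h'
  obtain ⟨ζ, h1, h2, h3, h4⟩ := IsCorner.exists_eq hB hB' (Nat.succ_ne_zero _) hc hc'
  by_contra hne
  refine disjoint_left.1 (hdisj hC hC' hne)
    (hB.mem_of_mem_interior (z := x₀ + ζ) (by simpa using h1) (by simpa using h2)) ?_
  rw [h4]
  exact hB'.mem_of_mem_interior (z := x₀' + ζ) (by simpa using h1) (by simpa using h3)

theorem IsBand.exists_ray (hu : u ≠ 0) (hE : IsFlatAtlas η u k P E) {σ w h : ℝ} {Ψ : ℂ → X}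
    {C : Set X} (hC : IsBand η u σ w h Ψ C) {x₀ : ℝ} (hx₀ : Ψ x₀ ∈ zeros η) :
    ∃ a : Ray k, Ψ x₀ = P a.1 ∧ IsCorner σ Ψ x₀ (E a.1) (k a.1 + 1) (a.2 : ℂˣ) := by
  rw [hE.zeros_eq] at hx₀
  obtain ⟨i, hi⟩ := hx₀
  obtain ⟨r, hr⟩ := hE.flat i
  obtain ⟨ξ, hξ, hcor⟩ := hC.exists_isCorner hu (k i).succ_ne_zero hr hi.symm
  obtain ⟨ζ, rfl⟩ := exists_rootsOfUnity (k i).succ_ne_zero hξ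
  exact ⟨⟨i, ζ⟩, hi.symm, hcor⟩

/-- A choice of a sector for each cylinder. -/
theorem exists_injective_ray [T2Space X] [CompactSpace X] (hu : ‖u‖ = 1)
    (hfin : ∀ x : X, ∃ k : ℕ, zeroOrder η x = k) (hE : IsFlatAtlas η u k P E)
    {𝒞 : Set (Set X)} (hcyl : ∀ C ∈ 𝒞, IsCylinder η u C) (hdisj : 𝒞.PairwiseDisjoint id)
    (hcov : ∀ x : X, x ∉ zeros η → x ∉ ⋃₀ 𝒞 → ∃ L, IsSaddleConnection η u L ∧ x ∈ L)
    {σ : ℝ} (hσ : σ = 1 ∨ σ = -1) :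
    ∃ f : 𝒞 → Ray k, f.Injective ∧ ∀ C : 𝒞, HasCorner η u k P E σ C (f C) := by
  have hu0 : u ≠ 0 := norm_ne_zero_iff.1 (hu ▸ one_ne_zero)
  have key : ∀ C : 𝒞, ∃ a : Ray k, HasCorner η u k P E σ C a := by
    rintro ⟨C, hC⟩
    obtain ⟨w, h, Ψ, hB⟩ := (hcyl C hC).exists_isBand hu hfin hσ
    obtain ⟨x₀, hx₀⟩ := hB.exists_zero hu hfin hcyl hdisj hC hcov
    obtain ⟨a, ha, hcor⟩ := hB.exists_ray hu0 hE hx₀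
    exact ⟨a, w, h, Ψ, x₀, hB, ha, hcor⟩
  choose f hf using key
  refine ⟨f, fun C C' hCC' ↦ Subtype.ext ?_, hf⟩
  have h1 := hf C'
  rw [← hCC'] at h1
  exact (hf C).eq h1 hdisj C.2 C'.2

/-- If there are as many cylinders as rays, the geodesic leaving a zero along a ray comes back to
the zero along an incoming ray bounding the same half-plane sector. -/
theorem exists_isSeparatrix_return [T2Space X] [CompactSpace X] (hu : ‖u‖ = 1)
    (hfin : ∀ x : X, ∃ k : ℕ, zeroOrder η x = k) (hE : IsFlatAtlas η u k P E)
    {𝒞 : Set (Set X)} (hcyl : ∀ C ∈ 𝒞, IsCylinder η u C) (hdisj : 𝒞.PairwiseDisjoint id)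
    (hcov : ∀ x : X, x ∉ zeros η → x ∉ ⋃₀ 𝒞 → ∃ L, IsSaddleConnection η u L ∧ x ∈ L)
    {σ : ℝ} (hσ : σ = 1 ∨ σ = -1) (hcard : Nat.card 𝒞 = ∑ i, (k i + 1)) (i : Fin n) :
    ∃ l c, IsSeparatrix η u l c (E i) (k i + 1) 1 ∧ ∀ᶠ ρ : ℝ in 𝓝[>] 0,
      c (l - ρ ^ (k i + 1)) ∈ (E i).source ∧
      E i (c (l - ρ ^ (k i + 1))) =
        ρ * Complex.exp (σ * Real.pi * Complex.I / (k i + 1 : ℕ)) := by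
  have hu0 : u ≠ 0 := norm_ne_zero_iff.1 (hu ▸ one_ne_zero)
  obtain ⟨f, hf, hfc⟩ := exists_injective_ray hu hfin hE hcyl hdisj hcov hσ
  have hfin𝒞 : Finite 𝒞 := Finite.of_injective f hf
  -- Equality of the counts makes the choice of sectors bijective: no cylinder can have a second
  -- corner on this edge.
  have hsurj : f.Surjective := by
    refine ((Nat.bijective_iff_injective_and_card f).2 ⟨hf, ?_⟩).surjective
    rw [card_ray, hcard]
  obtain ⟨C, hC⟩ := hsurj ⟨i, 1⟩
  obtain ⟨w, h, Ψ, x₀, hB, hx₀, hcor⟩ := hfc C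
  rw [hC] at hx₀ hcor
  simp only [OneMemClass.coe_one, Units.val_one] at hx₀ hcor
  have hedge : ∀ x : ℝ, (x : ℂ) ∈ {z : ℂ | 0 ≤ σ * z.im ∧ σ * z.im ≤ h} := fun x ↦ by
    simp [hB.height_pos.le]
  have hper : ∀ x : ℝ, Ψ ((x + w : ℝ) : ℂ) = Ψ x := fun x ↦ by
    rw [Complex.ofReal_add]
    exact hB.periodic x (hedge x).1 (hedge x).2
  refine ⟨w, fun s ↦ Ψ ((x₀ + s : ℝ) : ℂ), ⟨hB.width_pos, ?_, ?_, ?_, ?_⟩, ?_⟩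
  · exact hB.developed.comp (f := fun s : ℝ ↦ ((x₀ + s : ℝ) : ℂ)) (by fun_prop)
      (fun s _ ↦ hedge _) (fun s _ t _ ↦ by push_cast; ring)
  · rw [hper, hx₀, hE.zeros_eq]
    exact mem_range_self i
  -- A zero inside the edge would give another corner of `C`. By bijectivity it is the same sector,
  -- and the injectivity of `Ψ` modulo `w` makes `s` a multiple of `w`.
  · intro s hs hz
    obtain ⟨a, ha, hcora⟩ := hB.exists_ray hu0 hE hz
    obtain ⟨C', hC'⟩ := hsurj a
    have hCC' : C = C' := Subtype.ext <|
      HasCorner.eq (a := a) ⟨w, h, Ψ, _, hB, ha, hcora⟩ (hC' ▸ hfc C') hdisj C.2 C'.2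
    rw [← hCC', hC] at hC'
    subst hC'
    simp only [OneMemClass.coe_one, Units.val_one] at hcora
    obtain ⟨ζ, h1, h2, -, h4⟩ := IsCorner.exists_eq hB hB (Nat.succ_ne_zero _) hcor hcora
    obtain ⟨q, hq⟩ := (hB.inj (x₀ + ζ) (((x₀ + s : ℝ) : ℂ) + ζ) (by simpa using h1)
      (by simpa using h2) (by simpa using h1) (by simpa using h2)).1 h4
    have hq' : (s : ℂ) = ((q * w : ℝ) : ℂ) := by
      push_cast at hq ⊢
      linear_combination hq
    have hq'' : s = q * w := by exact_mod_cast hq'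
    obtain ⟨hs0, hsw⟩ := hs
    rw [hq''] at hs0 hsw
    have h5 : (0 : ℝ) < q := pos_of_mul_pos_left hs0 hB.width_pos.le
    have h6 : (q : ℝ) < 1 := by
      by_contra! hcon
      nlinarith [hB.width_pos]
    have h7 : 0 < q := by exact_mod_cast h5
    have h8 : q < 1 := by exact_mod_cast h6
    omega
  · filter_upwards [hcor] with ρ hρ
    have := hρ 0 (left_mem_Icc.2 Real.pi_pos.le)
    simpa using this
  -- By periodicity the end of the edge is the other side of the starting corner, at angle `α = π`.
  · filter_upwards [hcor] with ρ hρ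
    have h1 := hρ Real.pi (right_mem_Icc.2 Real.pi_pos.le)
    have h2 : Complex.exp (σ * Real.pi * Complex.I) = -1 := by
      rcases hσ with rfl | rfl
      · simp
      · rw [Complex.ofReal_neg, Complex.ofReal_one, neg_one_mul, neg_mul, Complex.exp_neg,
          Complex.exp_pi_mul_I]
        norm_num
    rw [h2] at h1
    have h3 : Ψ ((x₀ + (w - ρ ^ (k i + 1)) : ℝ) : ℂ) = Ψ (x₀ + ρ ^ (k i + 1) * (-1)) := by
      rw [show x₀ + (w - ρ ^ (k i + 1)) = (x₀ - ρ ^ (k i + 1)) + w by ring, hper]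
      congr 1
      push_cast
      ring
    change Ψ ((x₀ + (w - ρ ^ (k i + 1)) : ℝ) : ℂ) ∈ _ ∧ E i (Ψ ((x₀ + (w - ρ ^ (k i + 1)) : ℝ) : ℂ)) = _
    rw [h3]
    simpa using h1

/-- In a completely periodic direction there are fewer cylinders than outgoing rays. -/
theorem card_cylinders_lt [T2Space X] [CompactSpace X] (hu : ‖u‖ = 1)
    (hfin : ∀ x : X, ∃ k : ℕ, zeroOrder η x = k) (hE : IsFlatAtlas η u k P E)
    {𝒞 : Set (Set X)} (hcyl : ∀ C ∈ 𝒞, IsCylinder η u C) (hdisj : 𝒞.PairwiseDisjoint id)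
    (hcov : ∀ x : X, x ∉ zeros η → x ∉ ⋃₀ 𝒞 → ∃ L, IsSaddleConnection η u L ∧ x ∈ L)
    {i : Fin n} (hi : 1 ≤ k i) : 𝒞.Finite ∧ Nat.card 𝒞 < ∑ i, (k i + 1) := by
  obtain ⟨f, hf, -⟩ := exists_injective_ray hu hfin hE hcyl hdisj hcov (.inl rfl)
  have hfin𝒞 : Finite 𝒞 := Finite.of_injective f hf
  refine ⟨hfin𝒞, lt_of_le_of_ne ?_ fun hcard ↦ ?_⟩
  · rw [← card_ray]
    exact Nat.card_le_card_of_injective f hf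
  -- The ray of index `1` is followed along the cylinder on each of its two sides.
  obtain ⟨l, c, hc, hr⟩ := exists_isSeparatrix_return hu hfin hE hcyl hdisj hcov (.inl rfl) hcard i
  obtain ⟨l', c', hc', hr'⟩ :=
    exists_isSeparatrix_return hu hfin hE hcyl hdisj hcov (.inr rfl) hcard i
  have hll := hc.length_eq (Nat.succ_ne_zero _) hc'
  subst hll
  obtain ⟨ρ, h1, h2, h3, h4⟩ := (hr.and (hr'.and ((eventually_pow_lt (k i).succ_ne_zero hc.pos).and
    self_mem_nhdsWithin))).exists
  have hρ : (ρ : ℂ) ≠ 0 := Complex.ofReal_ne_zero.2 (ne_of_gt h4)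
  have heq := hc.eq_of_lt (Nat.succ_ne_zero _) hc' le_rfl (l - ρ ^ (k i + 1))
    ⟨sub_pos.2 h3.2, sub_lt_self _ h3.1⟩
  rw [heq] at h1
  have h5 := mul_left_cancel₀ hρ (h1.2.symm.trans h2.2)
  rw [Complex.exp_eq_exp_iff_exists_int] at h5
  obtain ⟨q, hq⟩ := h5
  have hmC : ((k i + 1 : ℕ) : ℂ) ≠ 0 := Nat.cast_ne_zero.2 (Nat.succ_ne_zero _)
  have hπ : (Real.pi : ℂ) ≠ 0 := Complex.ofReal_ne_zero.2 Real.pi_ne_zero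
  -- The two return angles `±π / (k i + 1)` differ by a multiple of `2π`.
  have h6 : (1 : ℂ) = q * (k i + 1 : ℕ) := by
    field_simp at hq
    push_cast at hq ⊢
    have h7 : (2 : ℂ) * 1 = 2 * (q * (k i + 1)) := by linear_combination hq
    exact mul_left_cancel₀ two_ne_zero h7
  have h7 : (1 : ℤ) = q * (k i + 1 : ℕ) := by exact_mod_cast h6
  have h8 : ((k i + 1 : ℕ) : ℤ) ∣ 1 := ⟨q, by rw [h7]; ring⟩
  have h9 := Int.le_of_dvd one_pos h8
  push_cast at h9
  omega

end OneForms

/-! ### Height functions and the transverse part of integrals -/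

section OneForms

variable {X : Type u} [TopologicalSpace X] [ChartedSpace ℂ X] [IsManifold 𝓘(ℂ, ℂ) ω X]
variable {η : HolomorphicOneForm X} {u : ℂ}

/-- The circle-valued height function of a cylinder, extended by zero. -/
theorem IsBand.exists_height [T2Space X] (hu : u ≠ 0) {w h : ℝ} {Ψ : ℂ → X} {C : Set X}
    (hC : IsBand η u 1 w h Ψ C) : ∃ f : X → AddCircle h, Continuous f ∧
      (∀ z : ℂ, 0 < z.im → z.im < h → f (Ψ z) = (z.im : AddCircle h)) ∧ ∀ x ∉ C, f x = 0 := by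
  classical
  have hex : ∀ x, ∃ y : ℝ, x ∈ C → ∃ z : ℂ, (0 < z.im ∧ z.im < h) ∧ Ψ z = x ∧ y = z.im := by
    intro x
    by_cases hx : x ∈ C
    · rw [hC.image_eq] at hx
      obtain ⟨z, ⟨h1, h2⟩, hz⟩ := hx
      rw [one_mul] at h1 h2
      exact ⟨z.im, fun _ ↦ ⟨z, ⟨h1, h2⟩, hz, rfl⟩⟩
    · exact ⟨0, fun h ↦ absurd h hx⟩
  choose y hy using hex
  set f : X → AddCircle h := fun x ↦ if x ∈ C then (y x : AddCircle h) else 0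
  have hf0 : ∀ x ∉ C, f x = 0 := fun x hx ↦ if_neg hx
  have hmem : ∀ z : ℂ, 0 < z.im → z.im < h → Ψ z ∈ C := fun z h1 h2 ↦
    hC.mem_of_mem_interior (by rwa [one_mul]) (by rwa [one_mul])
  have hfΨ : ∀ z : ℂ, 0 < z.im → z.im < h → f (Ψ z) = (z.im : AddCircle h) := by
    intro z h1 h2
    have hz := hmem z h1 h2
    obtain ⟨z', ⟨h1', h2'⟩, hz', hyz⟩ := hy _ hz
    obtain ⟨m, hm⟩ := (hC.inj z' z (by rwa [one_mul]) (by rwa [one_mul]) (by rwa [one_mul])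
      (by rwa [one_mul])).1 hz'
    have him : z.im = z'.im := by rw [hm]; simp
    rw [show f (Ψ z) = (y (Ψ z) : AddCircle h) from if_pos hz, hyz, him]
  refine ⟨f, continuous_def.2 fun O hO ↦ ?_, hfΨ, hf0⟩
  have hcoe : Continuous fun z : ℂ ↦ (z.im : AddCircle h) :=
    (AddCircle.continuous_mk' h).comp Complex.continuous_im
  by_cases h0 : (0 : AddCircle h) ∈ O
  -- When `0 ∈ O`, the complement of the preimage comes from a compact part of a closed fundamental
  -- domain; both edges have height `0` in the circle and drop out.
  · have hK : IsCompact ((Icc 0 w ×ℂ Icc 0 h) ∩ (fun z : ℂ ↦ (z.im : AddCircle h)) ⁻¹' Oᶜ) :=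
      (isCompact_Icc.reProdIm isCompact_Icc).inter_right (hO.isClosed_compl.preimage hcoe)
    have himage : f ⁻¹' Oᶜ =
        Ψ '' ((Icc 0 w ×ℂ Icc 0 h) ∩ (fun z : ℂ ↦ (z.im : AddCircle h)) ⁻¹' Oᶜ) := by
      ext x
      constructor
      · intro hx
        have hxC : x ∈ C := by
          by_contra hxC
          exact hx (by rw [hf0 x hxC]; exact h0)
        rw [hC.image_eq] at hxC
        obtain ⟨z, ⟨h1, h2⟩, rfl⟩ := hxC
        rw [one_mul] at h1 h2
        set q : ℤ := -⌊z.re / w⌋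
        have him : (z + q * w).im = z.im := by simp
        have hΨ : Ψ z = Ψ (z + q * w) := (hC.inj z _ (by rwa [one_mul]) (by rwa [one_mul])
          (by rwa [one_mul, him]) (by rwa [one_mul, him])).2 ⟨q, rfl⟩
        refine ⟨z + q * w, ⟨⟨?_, ?_⟩, ?_⟩, hΨ.symm⟩
        · have hre : (z + q * w).re = z.re - ⌊z.re / w⌋ * w := by simp [q]; ring
          have e1 := Int.floor_le (z.re / w)
          have e2 := (Int.lt_floor_add_one (z.re / w)).le
          rw [le_div_iff₀ hC.width_pos] at e1
          rw [div_le_iff₀ hC.width_pos] at e2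
          change (z + q * w).re ∈ Icc 0 w
          rw [hre]
          constructor <;> linarith
        · change (z + q * w).im ∈ Icc 0 h
          rw [him]; exact ⟨h1.le, h2.le⟩
        · change ((z + q * w).im : AddCircle h) ∈ Oᶜ
          rw [him, ← hfΨ z h1 h2]; exact hx
      · rintro ⟨z, ⟨⟨-, h1, h2⟩, hz⟩, rfl⟩
        have hz1 : z.im ≠ 0 := fun h ↦ hz (by
          change (z.im : AddCircle _) ∈ O
          rw [h]; exact h0)
        have hz2 : z.im ≠ h := fun h ↦ hz (by
          change (z.im : AddCircle _) ∈ O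
          rw [h, AddCircle.coe_period]; exact h0)
        change f (Ψ z) ∈ Oᶜ
        rw [hfΨ z (lt_of_le_of_ne h1 hz1.symm) (lt_of_le_of_ne h2 hz2)]
        exact hz
    have hcl : IsClosed (f ⁻¹' Oᶜ) := by
      rw [himage]
      refine (hK.image_of_continuousOn (hC.developed.1.mono ?_)).isClosed
      rintro z ⟨⟨-, h1, h2⟩, -⟩
      exact ⟨by rwa [one_mul], by rwa [one_mul]⟩
    rwa [preimage_compl, isClosed_compl_iff] at hcl
  -- When `0 ∉ O`, the preimage lies inside the open cylinder, where `Ψ` is an open map.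
  · rw [isOpen_iff_mem_nhds]
    intro x hx
    have hxC : x ∈ C := by
      by_contra hxC
      exact h0 (by rw [← hf0 x hxC]; exact hx)
    rw [hC.image_eq] at hxC
    obtain ⟨z, ⟨h1, h2⟩, rfl⟩ := hxC
    have hO' : (fun z : ℂ ↦ (z.im : AddCircle h)) ⁻¹' O ∈ 𝓝 z := by
      refine (hO.preimage hcoe).mem_nhds ?_
      change (z.im : AddCircle h) ∈ O
      rw [one_mul] at h1 h2
      rw [← hfΨ z h1 h2]; exact hx
    have hN := hC.image_mem_nhds hu h1 h2 (inter_mem ((isOpen_strip 1 0 h).mem_nhds ⟨h1, h2⟩) hO')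
    refine mem_of_superset hN ?_
    rintro _ ⟨z', ⟨⟨h3, h4⟩, h5⟩, rfl⟩
    change f (Ψ z') ∈ O
    rw [one_mul] at h3 h4
    rw [hfΨ z' h3 h4]
    exact h5

theorem im_conj_mul_self_mul (hu : ‖u‖ = 1) (z : ℂ) : (starRingEnd ℂ) u * (u * z) = z := by
  rw [← mul_assoc, ← Complex.normSq_eq_conj_mul_self, Complex.normSq_eq_norm_sq, hu]
  simp

/-- The cylinders of a completely periodic direction with their height functions. -/
structure HeightData (η : HolomorphicOneForm X) (u : ℂ) (ι : Type*) where
  cyl : ι → Set X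
  w : ι → ℝ
  h : ι → ℝ
  Ψ : ι → ℂ → X
  f : ∀ C : ι, X → AddCircle (h C)
  band : ∀ C, IsBand η u 1 (w C) (h C) (Ψ C) (cyl C)
  continuous_f : ∀ C, Continuous (f C)
  f_apply : ∀ C, ∀ z : ℂ, 0 < z.im → z.im < h C → f C (Ψ C z) = (z.im : AddCircle (h C))
  f_eq_zero : ∀ C, ∀ x ∉ cyl C, f C x = 0
  disjoint : Pairwise fun C C' ↦ Disjoint (cyl C) (cyl C')

variable {ι : Type*} [Fintype ι]

/-- Locally, the transverse coordinate is the sum of the heights in the cylinders. -/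
theorem HeightData.exists_local [T2Space X] (hu : ‖u‖ = 1)
    (hfin : ∀ x : X, ∃ k : ℕ, zeroOrder η x = k) (H : HeightData η u ι) (hz : (zeros η).Finite)
    (hL : {L | IsSaddleConnection η u L}.Finite)
    (hcov : ∀ x : X, x ∉ zeros η → (∀ C, x ∉ H.cyl C) → ∃ L, IsSaddleConnection η u L ∧ x ∈ L)
    (q : X) : ∃ (V : Set X) (G : X → ℂ) (lam : ι → X → ℝ), IsOpen V ∧ q ∈ V ∧
      IsPrimitiveOn η G V ∧ (∀ C, ContinuousOn (lam C) V) ∧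
      (∀ C, ∀ x ∈ V, (lam C x : AddCircle (H.h C)) = H.f C x) ∧
      ∀ x ∈ V, ((starRingEnd ℂ) u * (G x - G q)).im = ∑ C, (lam C x - lam C q) := by
  classical
  have hu0 : u ≠ 0 := norm_ne_zero_iff.1 (hu ▸ one_ne_zero)
  obtain ⟨k, hk⟩ := hfin q
  obtain ⟨e, r, he⟩ := exists_isFlatChart η hu0 hk
  have hloc : ∀ C, ∃ φ : OpenPartialHomeomorph ℝ (AddCircle (H.h C)),
      H.f C q ∈ φ.target ∧ ∀ y, φ y = (y : AddCircle (H.h C)) := by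
    intro C
    obtain ⟨y, hy⟩ := QuotientAddGroup.mk_surjective (H.f C q)
    obtain ⟨φ, hφ, hφc⟩ := AddCircle.isLocalHomeomorph_coe (H.h C) y
    refine ⟨φ, ?_, fun y ↦ by rw [← hφc]⟩
    have := φ.map_source hφ
    rw [← hφc] at this
    rwa [← hy]
  choose φ hφq hφ using hloc
  have hV₀ : IsOpen (⋂ C, H.f C ⁻¹' (φ C).target) :=
    isOpen_iInter_of_finite fun C ↦ (φ C).open_target.preimage (H.continuous_f C)
  have hpre : e.symm ⁻¹' (⋂ C, H.f C ⁻¹' (φ C).target) ∈ 𝓝 (0 : ℂ) := by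
    refine (e.symm.continuousAt ?_) (hV₀.mem_nhds ?_)
    · rw [e.symm_source, he.target_eq]; exact Metric.mem_ball_self he.pos
    · rw [he.symm_zero]; exact mem_iInter.2 hφq
  obtain ⟨ε, hε, hball⟩ := Metric.mem_nhds_iff.1 hpre
  set ε' := min ε r
  have hε' : 0 < ε' := lt_min hε he.pos
  have hsub : Metric.ball (0 : ℂ) ε' ⊆ e.target := by
    rw [he.target_eq]; exact Metric.ball_subset_ball (min_le_right _ _)
  set V := e.symm '' Metric.ball 0 ε'
  have hVo : IsOpen V := e.isOpen_image_symm_of_subset_target Metric.isOpen_ball hsub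
  have hqV : q ∈ V := ⟨0, Metric.mem_ball_self hε', he.symm_zero⟩
  have hVpre : IsPreconnected V := (convex_ball (0 : ℂ) ε').isPreconnected.image _
    (e.continuousOn_symm.mono hsub)
  have hVe : V ⊆ e.source := by
    rintro _ ⟨z, hz, rfl⟩; exact e.map_target (hsub hz)
  have hVφ : ∀ C, ∀ x ∈ V, H.f C x ∈ (φ C).target := by
    rintro C _ ⟨z, hz, rfl⟩
    exact mem_iInter.1 (hball (Metric.ball_subset_ball (min_le_left _ _) hz)) C
  set lam : ι → X → ℝ := fun C x ↦ (φ C).symm (H.f C x)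
  have hlamc : ∀ C, ContinuousOn (lam C) V := fun C ↦
    (φ C).continuousOn_symm.comp (H.continuous_f C).continuousOn (hVφ C)
  have hlam : ∀ C, ∀ x ∈ V, (lam C x : AddCircle (H.h C)) = H.f C x := fun C x hx ↦ by
    rw [← hφ, (φ C).right_inv (hVφ C x hx)]
  have hlam' : ∀ C, ∀ x ∈ V, x ∉ H.cyl C → (lam C x : AddCircle (H.h C)) = ((0 : ℝ) : AddCircle (H.h C)) :=
    fun C x hx hxC ↦ by rw [hlam C x hx, H.f_eq_zero C x hxC]; simp
  set G : X → ℂ := fun x ↦ u * e x ^ (k + 1)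
  have hG : IsPrimitiveOn η G V := fun y hy ↦ he.primitive y (hVe hy)
  -- The claim is that `F` is constant on the connected set `V`. Instead of a case analysis at the
  -- edges and zeros, it is enough that `F` is continuous with countably many values: it is locally
  -- constant on each cylinder and on the uncovered part of each saddle connection, and the zeros
  -- are finite in number.
  set F : X → ℝ := fun x ↦ ((starRingEnd ℂ) u * G x).im - ∑ C, lam C x
  have hFc : ContinuousOn F V := by
    refine ContinuousOn.sub ?_ (continuousOn_finsetSum _ fun C _ ↦ hlamc C)
    refine Complex.continuous_im.comp_continuousOn (continuousOn_const.mul fun x hx ↦ ?_)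
    exact (hG x hx).continuousAt.continuousWithinAt
  have hFdiff : ∀ x y, F x - F y =
      ((starRingEnd ℂ) u * (G x - G y)).im - ∑ C, (lam C x - lam C y) := fun x y ↦ by
    simp only [F, mul_sub, Complex.sub_im, Finset.sum_sub_distrib]
    ring
  have hFC : ∀ C, (F '' (V ∩ H.cyl C)).Countable := by
    intro C
    set W : Set ℂ := {z | (0 < 1 * z.im ∧ 1 * z.im < H.h C) ∧ H.Ψ C z ∈ V}
    have hW : V ∩ H.cyl C ⊆ H.Ψ C '' W := by
      rintro x ⟨hxV, hxC⟩
      rw [(H.band C).image_eq] at hxC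
      obtain ⟨z, hz, rfl⟩ := hxC
      exact ⟨z, ⟨hz, hxV⟩, rfl⟩
    refine Countable.mono (image_mono hW) ?_
    rw [← image_comp]
    have hdev : IsDevelopedBy η W (H.Ψ C) (fun z ↦ u * z) := (H.band C).developed.mono
      fun z hz ↦ ⟨hz.1.1.le, hz.1.2.le⟩
    refine countable_image_of_locally_const fun z hz ↦ ?_
    have hlamW : ∀ C', ContinuousWithinAt (fun z ↦ lam C' (H.Ψ C z)) W z := fun C' ↦
      (hlamc C').comp hdev.1 (fun z hz ↦ hz.2) z hz
    -- Inside `C` only its own height varies, at the same rate as `Im z`.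
    have h1 : ∀ᶠ z' in 𝓝[W] z, ∀ C', lam C' (H.Ψ C z') - lam C' (H.Ψ C z) =
        if C' = C then z'.im - z.im else 0 := by
      refine eventually_all.2 fun C' ↦ ?_
      split_ifs with hCC
      · subst hCC
        refine eventually_sub_eq_of_addCircle (H.band C').height_pos hz (hlamW C')
          (G := Complex.im) Complex.continuous_im.continuousWithinAt fun s hs ↦ ?_
        have h2 := hs.1
        rw [one_mul] at h2
        rw [hlam C' _ hs.2, H.f_apply C' s h2.1 h2.2]
      · have := eventually_sub_eq_of_addCircle (H.band C').height_pos hz (hlamW C')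
          (G := fun _ ↦ 0) continuousWithinAt_const fun s hs ↦ hlam' C' _ hs.2
            (disjoint_right.1 (H.disjoint hCC) ((H.band C).mem_of_mem_interior hs.1.1 hs.1.2))
        simpa only [sub_zero] using this
    filter_upwards [h1, hdev.eventually hz hVo hz.2 hG] with z' h2 h3
    rw [← sub_eq_zero]
    simp only [Function.comp_apply]
    rw [hFdiff, h3, ← mul_sub, im_conj_mul_self_mul hu, Finset.sum_congr rfl fun C' _ ↦ h2 C']
    simp
  have hFL : ∀ L, IsSaddleConnection η u L → (F '' (V ∩ L ∩ {x | ∀ C, x ∉ H.cyl C})).Countable := by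
    rintro L ⟨l, c, hl, hdev, -, -, rfl, -⟩
    set W : Set ℝ := {s | s ∈ Ioo 0 l ∧ c s ∈ V ∧ ∀ C, c s ∉ H.cyl C}
    have hW : V ∩ c '' Ioo 0 l ∩ {x | ∀ C, x ∉ H.cyl C} ⊆ c '' W := by
      rintro _ ⟨⟨hxV, s, hs, rfl⟩, hxC⟩
      exact ⟨s, ⟨hs, hxV, hxC⟩, rfl⟩
    refine Countable.mono (image_mono hW) ?_
    rw [← image_comp]
    have hdevW := hdev.mono (B := W) fun s hs ↦ Ioo_subset_Icc_self hs.1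
    refine countable_image_of_locally_const fun s hs ↦ ?_
    have h1 : ∀ᶠ s' in 𝓝[W] s, ∀ C', lam C' (c s') - lam C' (c s) = 0 := by
      refine eventually_all.2 fun C' ↦ ?_
      have := eventually_sub_eq_of_addCircle (F := fun s ↦ lam C' (c s)) (H.band C').height_pos hs
        ((hlamc C').comp hdevW.1 (fun z hz ↦ hz.2.1) s hs)
        (G := fun _ ↦ 0) continuousWithinAt_const fun s hs ↦ hlam' C' _ hs.2.1 (hs.2.2 C')
      simpa only [sub_zero] using this
    filter_upwards [h1, hdevW.eventually hs hVo hs.2.1 hG] with s' h2 h3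
    rw [← sub_eq_zero]
    simp only [Function.comp_apply]
    rw [hFdiff, h3, ← mul_sub, im_conj_mul_self_mul hu, Finset.sum_congr rfl fun C' _ ↦ h2 C']
    simp
  have hcount : (F '' V).Countable := by
    have hsub : F '' V ⊆ (F '' zeros η ∪ ⋃ C, F '' (V ∩ H.cyl C)) ∪
        ⋃ L ∈ {L | IsSaddleConnection η u L}, F '' (V ∩ L ∩ {x | ∀ C, x ∉ H.cyl C}) := by
      rintro _ ⟨x, hx, rfl⟩
      by_cases h1 : x ∈ zeros η
      · exact .inl (.inl ⟨x, h1, rfl⟩)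
      by_cases h2 : ∀ C, x ∉ H.cyl C
      · obtain ⟨L, hL, hxL⟩ := hcov x h1 h2
        exact .inr (mem_biUnion (x := L) hL ⟨x, ⟨⟨hx, hxL⟩, h2⟩, rfl⟩)
      · push Not at h2
        obtain ⟨C, hC⟩ := h2
        exact .inl (.inr (mem_iUnion.2 ⟨C, x, ⟨hx, hC⟩, rfl⟩))
    refine Countable.mono hsub (((hz.image F).countable.union (countable_iUnion hFC)).union ?_)
    exact hL.countable.biUnion fun L hL ↦ hFL L hL
  refine ⟨V, G, lam, hVo, hqV, hG, hlamc, hlam, fun x hx ↦ ?_⟩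
  have := eq_of_countable_image hVpre hFc hcount hx hqV
  rw [← sub_eq_zero, hFdiff] at this
  linarith

/-- The transverse part of an integral is the sum of the increments of the heights. -/
theorem HeightData.im_integral [T2Space X] (hu : ‖u‖ = 1)
    (hfin : ∀ x : X, ∃ k : ℕ, zeroOrder η x = k) (H : HeightData η u ι) (hz : (zeros η).Finite)
    (hL : {L | IsSaddleConnection η u L}.Finite)
    (hcov : ∀ x : X, x ∉ zeros η → (∀ C, x ∉ H.cyl C) → ∃ L, IsSaddleConnection η u L ∧ x ∈ L)
    {c : unitInterval → X} {D : unitInterval → ℂ} (hc : IsDevelopedBy η univ c D)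
    {θ : ι → unitInterval → ℝ} (hθc : ∀ C, Continuous (θ C))
    (hθ : ∀ C t, (θ C t : AddCircle (H.h C)) = H.f C (c t)) :
    ((starRingEnd ℂ) u * (D 1 - D 0)).im = ∑ C, (θ C 1 - θ C 0) := by
  have hcc : Continuous c := continuousOn_univ.1 hc.1
  set F : unitInterval → ℝ := fun t ↦ ((starRingEnd ℂ) u * D t).im - ∑ C, θ C t
  have hF : IsLocallyConstant F := by
    rw [IsLocallyConstant.iff_eventually_eq]
    intro t
    obtain ⟨V, G, lam, hVo, htV, hG, hlamc, hlam, hconst⟩ :=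
      H.exists_local hu hfin hz hL hcov (c t)
    set W := c ⁻¹' V
    have hW : W ∈ 𝓝 t := (hVo.preimage hcc).mem_nhds htV
    have h1 : ∀ᶠ s in 𝓝[W] t, ∀ C, θ C s - θ C t = lam C (c s) - lam C (c t) :=
      eventually_all.2 fun C ↦ eventually_sub_eq_of_addCircle (H.band C).height_pos htV
        (hθc C).continuousWithinAt (G := fun s ↦ lam C (c s))
        ((hlamc C).comp hcc.continuousOn (fun s hs ↦ hs) t htV)
        fun s hs ↦ by rw [hθ, hlam C _ hs]
    have h2 := hc.eventually (mem_univ t) hVo htV hG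
    rw [nhdsWithin_univ] at h2
    rw [nhdsWithin_eq_nhds.2 hW] at h1
    filter_upwards [h1, h2, hW] with s h3 h4 h5
    have h6 := hconst (c s) h5
    rw [h4, ← Finset.sum_congr rfl fun C _ ↦ h3 C] at h6
    simp only [mul_sub, Complex.sub_im, Finset.sum_sub_distrib] at h6
    simp only [F]
    linarith
  have := hF.apply_eq_of_preconnectedSpace 1 0
  simp only [F] at this
  simp only [mul_sub, Complex.sub_im, Finset.sum_sub_distrib]
  linarith

end OneForms

/-! ### Winding numbers -/

section Winding
variable {S : Type u} [TopologicalSpace S] {n : ℕ} {p : Fin n → S}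

/-- The increment of a lift of `f ∘ γ` depends only on the homotopy class of `γ`. -/
theorem exists_increment {h : ℝ} {f : S → AddCircle h} (hf : Continuous f)
    (hp : ∀ i, f (p i) = 0) {i j : Fin n} (a : Path.Homotopic.Quotient (p i) (p j)) :
    ∃ N : ℤ, ∀ γ : Path (p i) (p j), Path.Homotopic.Quotient.mk γ = a →
      ∀ θ : unitInterval → ℝ, Continuous θ → (∀ t, (θ t : AddCircle h) = f (γ t)) →
        θ 1 - θ 0 = N * h := by
  have cov := AddCircle.isCoveringMap_coe h
  set φ : C(S, AddCircle h) := ⟨f, hf⟩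
  obtain ⟨γ₀, rfl⟩ := Path.Homotopic.Quotient.mk_surjective a
  have hstart : ∀ γ : Path (p i) (p j), (φ.comp γ.toContinuousMap) 0 = ((0 : ℝ) : AddCircle h) :=
    fun γ ↦ by
      change f (γ 0) = _
      rw [γ.source, hp]; simp
  set Γ := cov.liftPath (φ.comp γ₀.toContinuousMap) 0 (hstart γ₀)
  have hΓ1 : ((Γ 1 : ℝ) : AddCircle h) = 0 := by
    have := congrFun (cov.liftPath_lifts (φ.comp γ₀.toContinuousMap) 0 (hstart γ₀)) 1
    refine this.trans ?_
    change f (γ₀ 1) = 0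
    rw [γ₀.target, hp]
  obtain ⟨N, hN⟩ := (AddCircle.coe_eq_zero_iff h).1 hΓ1
  refine ⟨N, fun γ hγ θ hθ hlift ↦ ?_⟩
  have hθ0 : ((θ 0 : ℝ) : AddCircle h) = 0 := by rw [hlift, γ.source, hp]
  have h1 : (fun t ↦ θ t - θ 0) = cov.liftPath (φ.comp γ.toContinuousMap) 0 (hstart γ) := by
    refine (cov.eq_liftPath_iff _).2 ⟨by fun_prop, ?_, by simp⟩
    funext t
    simp only [Function.comp_apply, AddCircle.coe_sub, hθ0, sub_zero, hlift]
    rfl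
  have h2 : γ.Homotopic γ₀ := Path.Homotopic.Quotient.exact hγ
  have h3 : (φ.comp γ.toContinuousMap).HomotopicRel (φ.comp γ₀.toContinuousMap) {0, 1} :=
    ContinuousMap.HomotopicRel.comp_continuousMap h2 φ
  have h4 := cov.liftPath_apply_one_eq_of_homotopicRel h3 0 (hstart γ) (hstart γ₀)
  rw [congrFun h1 1, h4, ← zsmul_eq_mul, hN]

/-- A circle-valued function that vanishes at the points `p i` defines an integral cohomology
class. -/
theorem exists_winding {h : ℝ} (hh : h ≠ 0) {f : S → AddCircle h} (hf : Continuous f)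
    (hp : ∀ i, f (p i) = 0) : ∃ N : RelativeHomology p →+ ℤ, ∀ (i j : Fin n)
      (γ : Path (p i) (p j)), ∃ θ : unitInterval → ℝ, Continuous θ ∧
        (∀ t, (θ t : AddCircle h) = f (γ t)) ∧ θ 1 - θ 0 = N (homologyClass p γ) * h := by
  have cov := AddCircle.isCoveringMap_coe h
  choose N hN using fun a : PathClass p ↦ exists_increment hf hp a.2.2
  have hlift : ∀ {x y : S} (γ : Path x y) (t₀ : ℝ), f x = (t₀ : AddCircle h) →
      ∃ θ : C(unitInterval, ℝ), (∀ t, (θ t : AddCircle h) = f (γ t)) ∧ θ 0 = t₀ := by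
    intro x y γ t₀ h0
    have h1 : ((⟨f, hf⟩ : C(S, AddCircle h)).comp γ.toContinuousMap) 0 = (t₀ : AddCircle h) := by
      change f (γ 0) = _
      rw [γ.source, h0]
    exact ⟨cov.liftPath _ t₀ h1, fun t ↦ congrFun (cov.liftPath_lifts _ t₀ h1) t,
      cov.liftPath_zero _ t₀ h1⟩
  set N₀ : FreeAbelianGroup (PathClass p) →+ ℤ := FreeAbelianGroup.lift N
  have hker : AddSubgroup.closure (concatRelations p) ≤ N₀.ker := by
    rw [AddSubgroup.closure_le]
    rintro _ ⟨i, j, l, α, β, rfl⟩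
    obtain ⟨α, rfl⟩ := Path.Homotopic.Quotient.mk_surjective α
    obtain ⟨β, rfl⟩ := Path.Homotopic.Quotient.mk_surjective β
    obtain ⟨θ, hθ, hθ0⟩ := hlift α 0 (by rw [hp]; simp)
    -- Starting the second lift where the first one ends makes their concatenation a lift along the
    -- composed path, so increments add.
    obtain ⟨θ', hθ', hθ'0⟩ := hlift β (θ 1) (by rw [hθ, α.target])
    set Θ : Path (θ 0) (θ' 1) := (⟨θ, rfl, rfl⟩ : Path (θ 0) (θ 1)).trans ⟨θ', hθ'0, rfl⟩
    have h1 := hN ⟨i, j, .mk α⟩ α rfl θ θ.continuous hθ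
    have h2 := hN ⟨j, l, .mk β⟩ β rfl θ' θ'.continuous hθ'
    have h3 := hN ⟨i, l, Path.Homotopic.Quotient.trans (.mk α) (.mk β)⟩ (α.trans β)
      (Path.Homotopic.Quotient.mk_trans α β) Θ Θ.continuous (fun t ↦ by
        simp only [Θ, Path.trans_apply]
        split_ifs
        · exact hθ _
        · exact hθ' _)
    rw [Θ.source, Θ.target] at h3
    have h4 : ((N ⟨i, l, Path.Homotopic.Quotient.trans (.mk α) (.mk β)⟩ : ℤ) : ℝ) =
        (N ⟨i, j, .mk α⟩ + N ⟨j, l, .mk β⟩ : ℤ) := by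
      push_cast
      refine mul_right_cancel₀ hh ?_
      rw [← h3, add_mul, ← h1, ← h2, hθ'0]
      ring
    have h5 : N ⟨i, l, Path.Homotopic.Quotient.trans (.mk α) (.mk β)⟩ =
        N ⟨i, j, .mk α⟩ + N ⟨j, l, .mk β⟩ := by exact_mod_cast h4
    change N₀ _ = 0
    simp only [N₀, map_sub, FreeAbelianGroup.lift_apply_of, h5]
    ring
  refine ⟨QuotientAddGroup.lift _ N₀ hker, fun i j γ ↦ ?_⟩
  obtain ⟨θ, hθ, -⟩ := hlift γ 0 (by rw [hp]; simp)
  refine ⟨θ, θ.continuous, hθ, ?_⟩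
  rw [hN ⟨i, j, .mk γ⟩ γ rfl θ θ.continuous hθ]
  congr 2
  exact (FreeAbelianGroup.lift_apply_of N _).symm

theorem addMonoidHom_ext_homologyClass {A : Type*} [AddCommGroup A]
    {φ ψ : RelativeHomology p →+ A}
    (h : ∀ (i j : Fin n) (γ : Path (p i) (p j)), φ (homologyClass p γ) = ψ (homologyClass p γ)) :
    φ = ψ := by
  refine QuotientAddGroup.addMonoidHom_ext _ (FreeAbelianGroup.lift_ext _ _ ?_)
  rintro ⟨i, j, a⟩
  obtain ⟨γ, rfl⟩ := Path.Homotopic.Quotient.mk_surjective a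
  exact h i j γ

end Winding

/-! ### Generic periods -/

section Generic

/-- By Fubini: for `x ≠ 0` the fibre is a real subspace of `ℂ` that misses `x * I`, hence null. -/
theorem volume_im_conj_mul_eq_zero :
    (volume : Measure (ℂ × ℂ)) {x | ((starRingEnd ℂ) x.1 * x.2).im = 0} = 0 := by
  have hcont : Continuous fun x : ℂ × ℂ ↦ ((starRingEnd ℂ) x.1 * x.2).im :=
    Complex.continuous_im.comp ((Complex.continuous_conj.comp continuous_fst).mul continuous_snd)
  refine Measure.measure_prod_null_of_ae_null
    (isClosed_singleton (x := (0 : ℝ)).preimage hcont).measurableSet ?_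
  have h0 : ∀ᵐ x : ℂ, x ≠ 0 := by simp [ae_iff]
  filter_upwards [h0] with x hx
  set s : Submodule ℝ ℂ := LinearMap.ker (Complex.imLm ∘ₗ LinearMap.mulLeft ℝ ((starRingEnd ℂ) x))
  refine Measure.addHaar_submodule volume s fun htop ↦ ?_
  have hmem : x * Complex.I ∈ s := htop ▸ Submodule.mem_top
  have h1 : ((starRingEnd ℂ) x * (x * Complex.I)).im = 0 := hmem
  rw [← mul_assoc, ← Complex.normSq_eq_conj_mul_self, Complex.im_ofReal_mul, Complex.I_im, mul_one,
    Complex.normSq_eq_zero] at h1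
  exact hx h1

/-- Generic linear combinations with independent integral coefficient vectors are not parallel. -/
theorem ae_im_conj_mul_ne_zero {d : ℕ} {a b : Fin d → ℤ} (hab : LinearIndependent ℤ ![a, b]) :
    ∀ᵐ z : Fin d → ℂ, ((starRingEnd ℂ) (∑ j, a j * z j) * ∑ j, b j * z j).im ≠ 0 := by
  rw [LinearIndependent.pair_iff] at hab
  -- Independence gives a nonzero `2 × 2` minor, and Cramer's rule then makes the map `L` below
  -- onto. Preimages of null sets under a surjective linear map are null.
  obtain ⟨i, j, hij⟩ : ∃ i j, a i * b j - a j * b i ≠ 0 := by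
    by_contra! hcon
    by_cases ha : a = 0
    · exact one_ne_zero (hab 1 0 (by simp [ha])).1
    · obtain ⟨i, hi⟩ := Function.ne_iff.1 ha
      refine hi (neg_eq_zero.1 (hab (b i) (-a i) ?_).2)
      funext j
      have := hcon i j
      simp only [Pi.add_apply, Pi.smul_apply, smul_eq_mul, Pi.zero_apply]
      linarith
  set L : (Fin d → ℂ) →ₗ[ℝ] ℂ × ℂ :=
    { toFun := fun z ↦ (∑ j, a j * z j, ∑ j, b j * z j)
      map_add' := fun z z' ↦ by simp [mul_add, Finset.sum_add_distrib]
      map_smul' := fun c z ↦ by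
        simp only [Pi.smul_apply, Complex.real_smul, RingHom.id_apply, Prod.smul_mk,
          Finset.mul_sum]
        congr 1 <;> exact Finset.sum_congr rfl fun _ _ ↦ by ring }
  have hL : Function.Surjective L := by
    rintro ⟨x, y⟩
    have hΔ : ((a i : ℂ) * b j - a j * b i) ≠ 0 := by exact_mod_cast hij
    set Δ : ℂ := (a i : ℂ) * b j - a j * b i
    refine ⟨Pi.single i ((b j * x - a j * y) / Δ) + Pi.single j ((a i * y - b i * x) / Δ), ?_⟩
    have hsum : ∀ (c : Fin d → ℤ) (s t : ℂ),
        ∑ l, (c l : ℂ) * ((Pi.single i s + Pi.single j t : Fin d → ℂ) l) = c i * s + c j * t := by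
      intro c s t
      simp [mul_add, Finset.sum_add_distrib, Pi.single_apply]
    refine Prod.ext ?_ ?_
    · change ∑ l, (a l : ℂ) * _ = x
      rw [hsum]
      field_simp
      simp only [Δ]; ring
    · change ∑ l, (b l : ℂ) * _ = y
      rw [hsum]
      field_simp
      simp only [Δ]; ring
  have hcont : Continuous fun x : ℂ × ℂ ↦ ((starRingEnd ℂ) x.1 * x.2).im :=
    Complex.continuous_im.comp ((Complex.continuous_conj.comp continuous_fst).mul continuous_snd)
  have hae : ∀ᵐ y : ℂ × ℂ, y ∈ {x : ℂ × ℂ | ((starRingEnd ℂ) x.1 * x.2).im = 0}ᶜ :=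
    compl_mem_ae_iff.2 volume_im_conj_mul_eq_zero
  have hhaar : (volume : Measure (ℂ × ℂ)).IsAddHaarMeasure := by
    rw [Measure.volume_eq_prod]; infer_instance
  exact (ae_comp_linearMap_mem_iff L volume volume hL
    (isClosed_singleton (x := (0 : ℝ)).preimage hcont).measurableSet.compl).2 hae

/-- Few integral functionals on a free group have two independent common zeros. -/
theorem exists_linearIndependent_pair_ker {A ι : Type*} [AddCommGroup A] [Fintype ι] {d : ℕ}
    (b : Module.Basis (Fin d) ℤ A) (N : ι → A →+ ℤ) (hd : Fintype.card ι + 2 ≤ d) :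
    ∃ x y : A, (∀ C, N C x = 0) ∧ (∀ C, N C y = 0) ∧
      LinearIndependent ℤ ![(b.repr x : Fin d → ℤ), (b.repr y : Fin d → ℤ)] := by
  have hfree : Module.Free ℤ A := .of_basis b
  have hfinite : Module.Finite ℤ A := .of_basis b
  set L : A →ₗ[ℤ] (ι → ℤ) := LinearMap.pi fun C ↦ (N C).toIntLinearMap
  -- By rank-nullity the kernel has rank at least `d - card ι ≥ 2`.
  have hrank := (LinearMap.ker L).finrank_quotient_add_finrank
  rw [L.quotKerEquivRange.finrank_eq, Module.finrank_eq_card_basis b, Fintype.card_fin] at hrank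
  have hrange : Module.finrank ℤ (LinearMap.range L) ≤ Fintype.card ι := by
    simpa using Submodule.finrank_le (LinearMap.range L)
  obtain ⟨f, hf⟩ := exists_linearIndependent_of_le_finrank (R := ℤ) (M := LinearMap.ker L) (n := 2)
    (by omega)
  have hker : ∀ (x : LinearMap.ker L) C, N C x = 0 := fun x C ↦ congrFun x.2 C
  refine ⟨f 0, f 1, hker _, hker _, ?_⟩
  have h1 : LinearIndependent ℤ fun i ↦ b.equivFun (f i : A) :=
    (hf.map' (LinearMap.ker L).subtype (Submodule.ker_subtype _)).map' b.equivFun.toLinearMap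
      b.equivFun.ker
  convert h1 using 1
  funext i
  fin_cases i <;> rfl

end Generic

/-! ### Parallel periods from a completely periodic direction -/

section Strata
variable {S : Type u} [TopologicalSpace S] {n d : ℕ} {p : Fin n → S} {k : Fin n → ℕ}

theorem MarkedSurface.exists_zeroOrder_eq (M : MarkedSurface p k) (x : M.X) :
    ∃ m : ℕ, zeroOrder M.form x = m := by
  by_cases hx : x ∈ zeros M.form
  · rw [M.zeros_eq] at hx
    obtain ⟨i, rfl⟩ := hx
    exact ⟨k i, M.zeroOrder_eq i⟩
  · exact ⟨0, zeroOrder_eq_zero _ hx⟩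

theorem MarkedSurface.exists_isFlatAtlas (M : MarkedSurface p k) {u : ℂ} (hu : u ≠ 0) :
    ∃ E, IsFlatAtlas M.form u k (fun i ↦ M.marking (p i)) E := by
  choose E r hE using fun i ↦ exists_isFlatChart M.form hu (M.zeroOrder_eq i)
  exact ⟨E, M.zeros_eq, fun i ↦ ⟨r i, hE i⟩⟩

theorem exists_heightData {X : Type u} [TopologicalSpace X] [ChartedSpace ℂ X]
    [IsManifold 𝓘(ℂ, ℂ) ω X] [T2Space X] [CompactSpace X] {η : HolomorphicOneForm X} {u : ℂ}
    (hu : ‖u‖ = 1) (hfin : ∀ x : X, ∃ k : ℕ, zeroOrder η x = k) {𝒞 : Set (Set X)}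
    (hcyl : ∀ C ∈ 𝒞, IsCylinder η u C) (hdisj : 𝒞.PairwiseDisjoint id) :
    ∃ H : HeightData η u 𝒞, ∀ C, H.cyl C = C := by
  choose w h Ψ hB using fun C : 𝒞 ↦ (hcyl C C.2).exists_isBand hu hfin (σ := 1) (.inl rfl)
  choose f hf1 hf2 hf3 using fun C : 𝒞 ↦
    (hB C).exists_height (norm_ne_zero_iff.1 (hu ▸ one_ne_zero))
  exact ⟨⟨fun C ↦ C, w, h, Ψ, f, hB, hf1, hf2, hf3,
    fun C C' hne ↦ hdisj C.2 C'.2 fun heq ↦ hne (Subtype.ext heq)⟩, fun _ ↦ rfl⟩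

/-- A completely periodic direction forces two independent relative homology classes to have
parallel periods. -/
theorem MarkedSurface.exists_parallel_periods (M : MarkedSurface p k)
    (b : Module.Basis (Fin d) ℤ (RelativeHomology p)) (hd : ∑ i, (k i + 1) + 1 ≤ d) {i₀ : Fin n}
    (hi₀ : 1 ≤ k i₀) {v : RelativeHomology p →+ ℂ} (hv : IsPeriodHom M v) {u : ℂ} (hu : ‖u‖ = 1)
    (hcp : IsCompletelyPeriodic M.form u) : ∃ x y : RelativeHomology p,
      LinearIndependent ℤ ![(b.repr x : Fin d → ℤ), (b.repr y : Fin d → ℤ)] ∧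
      ((starRingEnd ℂ) (v x) * v y).im = 0 := by
  have hu0 : u ≠ 0 := norm_ne_zero_iff.1 (hu ▸ one_ne_zero)
  obtain ⟨𝒞, hcyl, hdisj, hcov⟩ := hcp
  have hfin := M.exists_zeroOrder_eq
  obtain ⟨E, hE⟩ := M.exists_isFlatAtlas hu0
  obtain ⟨hfin𝒞, hcard⟩ := card_cylinders_lt hu hfin hE hcyl hdisj hcov hi₀
  have : Fintype 𝒞 := hfin𝒞.fintype
  obtain ⟨H, hH⟩ := exists_heightData hu hfin hcyl hdisj
  have hzfin : (zeros M.form).Finite := by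
    rw [M.zeros_eq]; exact finite_range _
  have hsad := finite_saddleConnections hu0 hE
  have hcov' : ∀ x : M.X, x ∉ zeros M.form → (∀ C, x ∉ H.cyl C) →
      ∃ L, IsSaddleConnection M.form u L ∧ x ∈ L := fun x hx hxC ↦ hcov x hx fun hmem ↦ by
    obtain ⟨C, hC, hxC'⟩ := hmem
    exact hxC ⟨C, hC⟩ (by rw [hH]; exact hxC')
  have hmark : ∀ i, M.marking (p i) ∈ zeros M.form := fun i ↦ by
    rw [M.zeros_eq]; exact mem_range_self i
  choose N hN using fun C ↦ exists_winding (p := p) (H.band C).height_pos.ne'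
    ((H.continuous_f C).comp M.marking.continuous)
    (fun i ↦ H.f_eq_zero C _ (disjoint_right.1 (H.band C).disjoint_zeros (hmark i)))
  -- As homomorphisms on relative homology, `Im (conj u * v) = ∑ h C * N C`; it suffices to compare
  -- them on paths.
  have hformula : (Complex.imAddGroupHom.comp
      ((AddMonoidHom.mulLeft ((starRingEnd ℂ) u)).comp v)) =
      ∑ C, (AddMonoidHom.mulRight (H.h C)).comp ((Int.castAddHom ℝ).comp (N C)) := by
    refine addMonoidHom_ext_homologyClass fun i j γ ↦ ?_
    obtain ⟨D, hD, hD1⟩ := hv i j γ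
    choose θ hθc hθ hθ1 using fun C ↦ hN C i j γ
    have := H.im_integral hu hfin hzfin hsad hcov' hD hθc (fun C t ↦ hθ C t)
    rw [hD1] at this
    simpa [hθ1] using this
  obtain ⟨x, y, hx, hy, hxy⟩ := exists_linearIndependent_pair_ker b N (by
    rw [← Nat.card_eq_fintype_card]; omega)
  have hreal : ∀ x, (∀ C, N C x = 0) → ((starRingEnd ℂ) u * v x).im = 0 := fun x hx ↦ by
    have := DFunLike.congr_fun hformula x
    simpa [hx] using this
  refine ⟨x, y, hxy, ?_⟩
  -- Rotating both periods by the unit `conj u` leaves this product unchanged and makes both of them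
  -- real.
  have h1 : (starRingEnd ℂ) (v x) * v y =
      (starRingEnd ℂ) ((starRingEnd ℂ) u * v x) * ((starRingEnd ℂ) u * v y) := by
    have h2 : u * (starRingEnd ℂ) u = 1 := by
      rw [Complex.mul_conj, Complex.normSq_eq_norm_sq, hu]; simp
    rw [map_mul, Complex.conj_conj]
    linear_combination (-(starRingEnd ℂ) (v x) * v y) * h2
  rw [h1, Complex.mul_im, Complex.conj_im, hreal x hx, hreal y hy]
  simp

end Strata

end TranslationSurface

theorem mainTheorem9 {S : Type*} [TopologicalSpace S] {g n : ℕ} (hg : 2 ≤ g)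
    (k : Fin n → ℕ) (hk : ∀ i, 1 ≤ k i) (hsum : ∑ i, k i = 2 * g - 2)
    (p : Fin n → S) (hp : Function.Injective p)
    (b : Module.Basis (Fin (2 * g + n - 1)) ℤ (TranslationSurface.RelativeHomology p)) :
    ∀ᵐ z : Fin (2 * g + n - 1) → ℂ, ∀ M : TranslationSurface.MarkedSurface p k,
      TranslationSurface.HasPeriodCoordinates b M z →
        ¬ ∃ u : ℂ, ‖u‖ = 1 ∧ TranslationSurface.IsCompletelyPeriodic M.form u := by
  -- Pairs of integer vectors are countable, so one null set serves all of them.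
  have hae : ∀ᵐ z : Fin (2 * g + n - 1) → ℂ, ∀ ab : (Fin (2 * g + n - 1) → ℤ) ×
      (Fin (2 * g + n - 1) → ℤ), LinearIndependent ℤ ![ab.1, ab.2] →
      ((starRingEnd ℂ) (∑ j, ab.1 j * z j) * ∑ j, ab.2 j * z j).im ≠ 0 := by
    refine ae_all_iff.2 fun ab ↦ ?_
    by_cases h : LinearIndependent ℤ ![ab.1, ab.2]
    · filter_upwards [TranslationSurface.ae_im_conj_mul_ne_zero h] with z hz _ using hz
    · exact ae_of_all _ fun z h' ↦ absurd h' h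
  filter_upwards [hae] with z hz M
  rintro ⟨v, hv, hzv⟩ ⟨u, hu, hcp⟩
  have hn : 0 < n := by
    rcases Nat.eq_zero_or_pos n with rfl | h
    · simp at hsum; omega
    · exact h
  -- This is an equality, so the strict bound on the cylinders leaves exactly the two spare
  -- dimensions needed.
  have hd : ∑ i, (k i + 1) + 1 ≤ 2 * g + n - 1 := by
    rw [Finset.sum_add_distrib, hsum]
    simp
    omega
  obtain ⟨x, y, hxy, him⟩ := M.exists_parallel_periods b hd (hk ⟨0, hn⟩) hv hu hcp
  have hval : ∀ x, v x = ∑ j, (b.repr x j : ℂ) * z j := fun x ↦ by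
    conv_lhs => rw [← b.sum_repr x]
    rw [map_sum]
    exact Finset.sum_congr rfl fun j _ ↦ by rw [map_zsmul, zsmul_eq_mul, hzv]
  refine hz (b.repr x, b.repr y) hxy ?_
  rw [← hval, ← hval]
  exact him
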